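/- Conventions. All manifolds are (Hausdorff, paracompact, finite-dimensional) complex manifolds, all locally free sheaves are of finite rank, and cohomology is Čech cohomology (the direct limit over open covers). Supermanifolds. Let $V$ be a locally free sheaf on a complex manifold $Y$. For $j\ge 2$ let $\mathcal G^{(j)}_V$ be the sheaf of groups of automorphisms $\alpha$ of the sheaf of $\mathbb Z/2$-graded algebras $\wedge^\bullet V$ with $\alpha(u)-u\in\bigoplus_{k\ge j}\wedge^kV$ for all local sections $u$. A supermanifold modelled on $(Y,V)$ of splitting type $j$ is a $1$-cocycle $\vartheta=(\vartheta_{\alpha\beta})$, $\vartheta_{\alpha\gamma}=\vartheta_{\beta\gamma}\circ\vartheta_{\alpha\beta}$, of an open cover of $Y$ with values in $\mathcal G^{(j)}_V$; its structure sheaf is obtained by gluing the restrictions of $\wedge^\bullet V$ along $\vartheta$, and morphisms of supermanifolds are morphisms of locally ringed spaces of $\mathbb Z/2$-graded algebras. Put $V_{(\pm)^j}=T^*_Y$ if $j$ is even and $V_{(\pm)^j}=V$ if $j$ is odd. One has $\mathcal G^{(j)}_V/\mathcal G^{(j+1)}_V\cong\mathcal A^{(j)}_V:=\mathcal Hom(V_{(\pm)^j},\wedge^jV)$,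 where $\alpha$ corresponds to $a$ with $\alpha(f)\equiv f+a(df)$ ($j$ even, $f$ a function), respectively $\alpha(\theta)\equiv\theta+a(\theta)$ ($j$ odd, $\theta$ a section of $V$), modulo $\bigoplus_{k>j}\wedge^kV$. The image of the class of $\vartheta$ in $H^1(Y,\mathcal A^{(j)}_V)$ is the obstruction to splitting the supermanifold. gt-models. Let $X,B$ be complex manifolds, $T_X$ and $T_B$ locally free sheaves on $X$ and $B$, and $Y=X\times B$ with projections $p_X,p_B$. A gt-model $(Y,T_Y)$ over $(B,T_B)$ with fibre $(X,T_X)$ is a locally free sheaf $T_Y$ on $Y$ with a short exact sequence $$0\to p_B^*T_B\xrightarrow{\ \iota\ }T_Y\to p_X^*T_X\to0 .$$ Its model class $\Theta\in H^1(Y,\mathcal Hom(p_X^*T_X,p_B^*T_B))=\mathrm{Ext}^1(p_X^*T_X,p_B^*T_B)$ is the class of this extension. For $b\ge0$ let $T_{(\pm)^{b+1}}=(T_Y)_{(\pm)^{b+1}}$ and $$\mathbf H^{1,b}_n=H^n\big(Y,\mathcal Hom(T_{(\pm)^{b+1}},\wedge^bp_B^*T_B\otimes p_X^*T_X)\big),\qquad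 \mathbf H^{0,b+1}_n=H^n\big(Y,\mathcal Hom(T_{(\pm)^{b+1}},\wedge^{b+1}p_B^*T_B)\big).$$ The model class map $(\Theta,-)_*:\mathbf H^{1,b}_1\to\mathbf H^{0,b+1}_2$ is the cup product with $\Theta$, followed by the map induced by the composition $\wedge^bp_B^*T_B\otimes p_X^*T_X\to\wedge^bp_B^*T_B\otimes p_B^*T_B\to\wedge^{b+1}p_B^*T_B$. gtm-families. A gtm-family over the reduced base $B$ modelled on $(X,T_X)$ ($X$ compact) is a supermanifold $\mathcal X$ modelled on $(Y,p_X^*T_X)$ with a morphism $\mathcal X\to B$ lifting $p_B$, such that for each $t\in B$ some supermanifold modelled on $(X,T_X)$ embeds into $\mathcal X$ over the point $t$, lifting $x\mapsto(x,t)$ and inducing the canonical map of odd conormal sheaves. A gtm-family of splitting type $j$ with total space model $(Y,T_Y)$ is a morphism $\widetilde{\mathcal X}\to\widetilde B$ lifting $p_B$, from a supermanifold modelled on $(Y,T_Y)$ of splitting type $j$ to a supermanifold modelled on $(B,T_B)$, together with a gtm-family $\mathcal X\to B$ over the reduced base modelled on $(X,T_X)$ and a morphism $\mathcal X\to\widetilde{\mathcal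 X}$ which lies over the natural embedding $B\subset\widetilde B$, is the identity of $Y$ on reduced spaces, and induces $T_Y\to p_X^*T_X$ on odd conormal sheaves. Secondary obstructions. Let $j'=b+1\ge2$. In $\wedge^{b+1}T_Y$ let $F_b$ be the image of $\wedge^bp_B^*T_B\otimes T_Y$ and $F_{b+1}=\wedge^{b+1}\iota(p_B^*T_B)$, so that $F_b/F_{b+1}\cong\wedge^bp_B^*T_B\otimes p_X^*T_X$. A class $\nu\in\mathbf H^{1,b}_1$ is a secondary obstruction to splitting a gtm-family of splitting type $b+1$ with total space model $(Y,T_Y)$ if the obstruction $\omega\in H^1(Y,\mathcal A^{(b+1)}_{T_Y})$ to splitting its total space does not lie in the image of $H^1(Y,\mathcal Hom(T_{(\pm)^{b+1}},F_{b+1}))$ and is the image of some $w\in H^1(Y,\mathcal Hom(T_{(\pm)^{b+1}},F_b))$ whose image in $\mathbf H^{1,b}_1$ is $\nu$. Theorem. Let $(Y,T_Y)$ be a gt-model with model class $\Theta\neq0$, let $j'\ge2$, and suppose that some $\nu\in\mathbf H^{1,j'-1}_1$ satisfies $(\Theta,\nu)_*\neq0$ in $\mathbf H^{0,j'}_2$.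 Then there is a non-zero class $\nu'\in\mathbf H^{1,j'-1}_1$ that is not a secondary obstruction to splitting any gtm-family of splitting type $j'$ with total space model $(Y,T_Y)$. -/

import Mathlib

open scoped Manifold ContDiff Topology TensorProduct
open TopologicalSpace (Opens)

universe u

noncomputable section

/-! ### Sheaves of holomorphic sections on a complex manifold -/

section HolSheaf

variable {E : Type u} [NormedAddCommGroup E] [NormedSpace ℂ E]
  {H : Type u} [TopologicalSpace H] (I : ModelWithCorners ℂ E H)
  (Y : Type u) [TopologicalSpace Y] [ChartedSpace H Y]

variable {Y} in
/-- The function `f` is holomorphic near `y₀`. -/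
def HolFunAt (f : Y → ℂ) (y₀ : Y) : Prop := ContMDiffAt I 𝓘(ℂ, ℂ) ω f y₀

/-- A sheaf of `𝒪_Y`-modules given as the sheaf of holomorphic sections of a family of complex
vector spaces `fib y`, `y ∈ Y`. The sheaf is recorded by saying which germs of set-theoretic
sections are holomorphic: `HolAt s y₀` says that the germ of `s` at `y₀` is holomorphic.
The objects of interest are the locally free sheaves (`HolSheaf.ofBundle`) and what is built from
them by pull-back, tensor product, `Hom` and exterior powers. -/
structure HolSheaf where
  /-- the fibres -/
  fib : Y → Type u
  [grp : ∀ y, AddCommGroup (fib y)]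
  [mod : ∀ y, Module ℂ (fib y)]
  /-- the holomorphic germs -/
  HolAt : (∀ y, fib y) → Y → Prop
  congr' : ∀ {s t : ∀ y, fib y} {y₀ : Y}, HolAt s y₀ → (∀ᶠ y in 𝓝 y₀, s y = t y) → HolAt t y₀
  zero' : ∀ y₀ : Y, HolAt (fun _ => 0) y₀
  add' : ∀ {s t : ∀ y, fib y} {y₀ : Y}, HolAt s y₀ → HolAt t y₀ → HolAt (fun y => s y + t y) y₀
  smul' : ∀ {f : Y → ℂ} {s : ∀ y, fib y} {y₀ : Y},
    HolFunAt I f y₀ → HolAt s y₀ → HolAt (fun y => f y • s y) y₀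

attribute [instance] HolSheaf.grp HolSheaf.mod

end HolSheaf

namespace HolSheaf

section Basic

variable {E : Type u} [NormedAddCommGroup E] [NormedSpace ℂ E]
  {H : Type u} [TopologicalSpace H] {I : ModelWithCorners ℂ E H}
  {Y : Type u} [TopologicalSpace Y] [ChartedSpace H Y]

theorem const_smul' (V : HolSheaf I Y) (c : ℂ) {s : ∀ y, V.fib y} {y₀ : Y}
    (hs : V.HolAt s y₀) : V.HolAt (fun y => c • s y) y₀ :=
  V.smul' (f := fun _ => c) contMDiffAt_const hs

theorem sub' (V : HolSheaf I Y) {s t : ∀ y, V.fib y} {y₀ : Y}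
    (hs : V.HolAt s y₀) (ht : V.HolAt t y₀) : V.HolAt (fun y => s y - t y) y₀ :=
  V.congr' (V.add' hs (V.const_smul' (-1) ht))
    (Filter.Eventually.of_forall fun y => by simp [sub_eq_add_neg])

open Classical in
/-- Extension by zero of a set-theoretic section over `U`. -/
def extZero (V : HolSheaf I Y) (U : Opens Y) (s : ∀ y : U, V.fib y) : ∀ y, V.fib y :=
  fun y => if h : y ∈ U then s ⟨y, h⟩ else 0

theorem extZero_of_mem (V : HolSheaf I Y) {U : Opens Y} (s : ∀ y : U, V.fib y) {y : Y}
    (h : y ∈ U) : V.extZero U s y = s ⟨y, h⟩ := by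
  simp [extZero, h]

theorem extZero_res (V : HolSheaf I Y) {U W : Opens Y} (h : U ≤ W) (s : ∀ y : W, V.fib y)
    {y : Y} (hy : y ∈ U) :
    V.extZero U (fun y => s ⟨y, h y.2⟩) y = V.extZero W s y := by
  rw [extZero_of_mem _ _ hy, extZero_of_mem _ _ (h hy)]

/-- The holomorphic sections of `V` over the open set `U`. -/
def sections (V : HolSheaf I Y) (U : Opens Y) : Submodule ℂ (∀ y : U, V.fib y) where
  carrier := {s | ∀ y : U, V.HolAt (V.extZero U s) y}
  add_mem' {s t} hs ht y := V.congr' (V.add' (hs y) (ht y))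
    (Filter.eventually_of_mem (U.isOpen.mem_nhds y.2) fun z hz => by
      simp [extZero_of_mem _ _ (show z ∈ U from hz)])
  zero_mem' y := V.congr' (V.zero' y)
    (Filter.eventually_of_mem (U.isOpen.mem_nhds y.2) fun z hz => by
      simp [extZero_of_mem _ _ (show z ∈ U from hz)])
  smul_mem' c s hs y := V.congr' (V.const_smul' c (hs y))
    (Filter.eventually_of_mem (U.isOpen.mem_nhds y.2) fun z hz => by
      simp [extZero_of_mem _ _ (show z ∈ U from hz)])

theorem sections_res (V : HolSheaf I Y) {U W : Opens Y} (h : U ≤ W) {s : ∀ y : W, V.fib y}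
    (hs : s ∈ V.sections W) : (fun y : U => s ⟨y, h y.2⟩) ∈ V.sections U := fun y =>
  V.congr' (hs ⟨y, h y.2⟩) (Filter.eventually_of_mem (U.isOpen.mem_nhds y.2) fun _ hz =>
    (V.extZero_res h s hz).symm)

/-- Restriction of sections. -/
def res (V : HolSheaf I Y) {U W : Opens Y} (h : U ≤ W) : V.sections W →ₗ[ℂ] V.sections U where
  toFun s := ⟨fun y => s.1 ⟨y, h y.2⟩, V.sections_res h s.2⟩
  map_add' _ _ := rfl
  map_smul' _ _ := rfl

/-- Morphisms of sheaves of sections given by fibrewise linear maps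
(for locally free sheaves: all `𝒪_Y`-linear morphisms). -/
structure Hom (V W : HolSheaf I Y) where
  app : ∀ y, V.fib y →ₗ[ℂ] W.fib y
  hol : ∀ {s : ∀ y, V.fib y} {y₀ : Y}, V.HolAt s y₀ → W.HolAt (fun y => app y (s y)) y₀

/-- Holomorphic bilinear pairings `V × W → P`. -/
structure Pairing (V W P : HolSheaf I Y) where
  app : ∀ y, V.fib y →ₗ[ℂ] W.fib y →ₗ[ℂ] P.fib y
  hol : ∀ {s : ∀ y, V.fib y} {t : ∀ y, W.fib y} {y₀ : Y}, V.HolAt s y₀ → W.HolAt t y₀ →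
    P.HolAt (fun y => app y (s y) (t y)) y₀

theorem Hom.mem_sections {V W : HolSheaf I Y} (φ : Hom V W) {U : Opens Y} {s : ∀ y : U, V.fib y}
    (hs : s ∈ V.sections U) : (fun y : U => φ.app y (s y)) ∈ W.sections U := fun y =>
  W.congr' (φ.hol (hs y)) (Filter.eventually_of_mem (U.isOpen.mem_nhds y.2) fun z hz => by
    simp [extZero_of_mem _ _ (show z ∈ U from hz)])

theorem Pairing.mem_sections {V W P : HolSheaf I Y} (β : Pairing V W P) {U : Opens Y}
    {s : ∀ y : U, V.fib y} {t : ∀ y : U, W.fib y}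
    (hs : s ∈ V.sections U) (ht : t ∈ W.sections U) :
    (fun y : U => β.app y (s y) (t y)) ∈ P.sections U := fun y =>
  P.congr' (β.hol (hs y) (ht y))
    (Filter.eventually_of_mem (U.isOpen.mem_nhds y.2) fun z hz => by
      simp [extZero_of_mem _ _ (show z ∈ U from hz)])

end Basic

section Constructions

variable {E : Type u} [NormedAddCommGroup E] [NormedSpace ℂ E]
  {H : Type u} [TopologicalSpace H] {I : ModelWithCorners ℂ E H}
  {Y : Type u} [TopologicalSpace Y] [ChartedSpace H Y]

variable (I) in
/-- The locally free sheaf of holomorphic sections of a holomorphic vector bundle. -/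
def ofBundle (F : Type u) [NormedAddCommGroup F] [NormedSpace ℂ F] (V : Y → Type u)
    [TopologicalSpace (Bundle.TotalSpace F V)] [∀ y, AddCommGroup (V y)] [∀ y, Module ℂ (V y)]
    [∀ y, TopologicalSpace (V y)] [FiberBundle F V] [VectorBundle ℂ F V]
    [ContMDiffVectorBundle ω F V I] : HolSheaf I Y where
  fib := V
  HolAt s y₀ := ContMDiffAt I (I.prod 𝓘(ℂ, F)) ω (fun y => Bundle.TotalSpace.mk' F y (s y)) y₀
  congr' hs h := hs.congr_of_eventuallyEq (by
    filter_upwards [h] with y hy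
    rw [hy])
  zero' y₀ := (Bundle.contMDiff_zeroSection ℂ V).contMDiffAt
  add' hs ht := ContMDiffAt.add_section hs ht
  smul' hf hs := ContMDiffAt.smul_section hf hs

variable (I Y) in
/-- The holomorphic cotangent sheaf `T^*_Y`: a covector field is holomorphic when it pairs
holomorphic vector fields to holomorphic functions. -/
def cotangent [IsManifold I ω Y] : HolSheaf I Y where
  fib y := TangentSpace I y →ₗ[ℂ] ℂ
  HolAt φ y₀ := ∀ v : ∀ y, TangentSpace I y,
    ContMDiffAt I I.tangent ω (fun y => (⟨y, v y⟩ : TangentBundle I Y)) y₀ →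
    HolFunAt I (fun y => φ y (v y)) y₀
  congr' hs h v hv := (hs v hv).congr_of_eventuallyEq (by
    filter_upwards [h] with y hy
    rw [hy])
  zero' y₀ v _ := by simpa [HolFunAt] using contMDiffAt_const
  add' hs ht v hv := ContMDiffAt.add (hs v hv) (ht v hv)
  smul' hf hs v hv := ContMDiffAt.smul hf (hs v hv)

variable (I Y) in
/-- The zero sheaf. -/
def zeroSheaf : HolSheaf I Y where
  fib _ := PUnit
  HolAt _ _ := True
  congr' _ _ := trivial
  zero' _ := trivial
  add' _ _ := trivial
  smul' _ _ := trivial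

/-- The sheaf `ℋom(V, W)`. -/
def hom (V W : HolSheaf I Y) : HolSheaf I Y where
  fib y := V.fib y →ₗ[ℂ] W.fib y
  HolAt φ y₀ := ∀ s : ∀ y, V.fib y, V.HolAt s y₀ → W.HolAt (fun y => φ y (s y)) y₀
  congr' hφ h s hs := W.congr' (hφ s hs) (by
    filter_upwards [h] with y hy
    rw [hy])
  zero' y₀ s _ := W.zero' y₀
  add' hφ hψ s hs := W.add' (hφ s hs) (hψ s hs)
  smul' hf hφ s hs := W.smul' hf (hφ s hs)

/-- Germs generated, as a module over holomorphic functions, by a set `G` of sections: the germ of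
`s` at `y₀` is that of a finite sum `∑ fᵢ gᵢ` with `fᵢ` holomorphic at `y₀` and `gᵢ ∈ G`. -/
def GenAt (I : ModelWithCorners ℂ E H) {V : Y → Type u} [∀ y, AddCommGroup (V y)]
    [∀ y, Module ℂ (V y)] (G : Set (∀ y, V y)) (s : ∀ y, V y) (y₀ : Y) : Prop :=
  ∃ w ∈ Submodule.span ℂ {w : ∀ y, V y | ∃ f : Y → ℂ, HolFunAt I f y₀ ∧ ∃ g ∈ G,
    w = fun y => f y • g y}, ∀ᶠ y in 𝓝 y₀, s y = w y

section GenAt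

variable {V : Y → Type u} [∀ y, AddCommGroup (V y)] [∀ y, Module ℂ (V y)]
  {G : Set (∀ y, V y)} {s t : ∀ y, V y} {y₀ : Y}

theorem GenAt.congr (hs : GenAt I G s y₀) (h : ∀ᶠ y in 𝓝 y₀, s y = t y) : GenAt I G t y₀ := by
  obtain ⟨w, hw, hsw⟩ := hs
  exact ⟨w, hw, by filter_upwards [h, hsw] with y h1 h2; rw [← h1, h2]⟩

theorem GenAt.zero (G : Set (∀ y, V y)) (y₀ : Y) : GenAt I G (fun _ => 0) y₀ :=
  ⟨0, Submodule.zero_mem _, by simp⟩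

theorem GenAt.add (hs : GenAt I G s y₀) (ht : GenAt I G t y₀) :
    GenAt I G (fun y => s y + t y) y₀ := by
  obtain ⟨w, hw, hsw⟩ := hs
  obtain ⟨w', hw', htw⟩ := ht
  exact ⟨w + w', Submodule.add_mem _ hw hw', by
    filter_upwards [hsw, htw] with y h1 h2; rw [h1, h2]; rfl⟩

theorem GenAt.smul {f : Y → ℂ} (hf : HolFunAt I f y₀) (hs : GenAt I G s y₀) :
    GenAt I G (fun y => f y • s y) y₀ := by
  obtain ⟨w, hw, hsw⟩ := hs
  refine ⟨fun y => f y • w y, ?_, by filter_upwards [hsw] with y h1; rw [h1]⟩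
  clear hsw
  induction hw using Submodule.span_induction with
  | mem w hw =>
    obtain ⟨g, hg, v, hv, rfl⟩ := hw
    refine Submodule.subset_span ⟨fun y => f y * g y, ContMDiffAt.mul hf hg, v, hv, ?_⟩
    funext y
    simp [mul_smul]
  | zero =>
    refine (congrArg (· ∈ _) ?_).mp (Submodule.zero_mem _)
    funext y
    simp
  | add v w _ _ h1 h2 =>
    refine (congrArg (· ∈ _) ?_).mp (Submodule.add_mem _ h1 h2)
    funext y
    simp
  | smul c w _ h =>
    have := Submodule.smul_mem _ c h
    refine (congrArg (· ∈ _) ?_).mp this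
    funext y
    simp [smul_comm c (f y)]

theorem GenAt.of_mem (hs : s ∈ G) : GenAt I G s y₀ :=
  ⟨s, Submodule.subset_span ⟨fun _ => 1, contMDiffAt_const, s, hs, by simp⟩, by simp⟩

/-- Induction principle: a fibrewise linear map sends generated germs to holomorphic germs as soon
as it does so on generators. -/
theorem GenAt.map {W : HolSheaf I Y} (φ : ∀ y, V y →ₗ[ℂ] W.fib y)
    (hG : ∀ g ∈ G, W.HolAt (fun y => φ y (g y)) y₀) (hs : GenAt I G s y₀) :
    W.HolAt (fun y => φ y (s y)) y₀ := by
  obtain ⟨w, hw, hsw⟩ := hs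
  suffices W.HolAt (fun y => φ y (w y)) y₀ from
    W.congr' this (by filter_upwards [hsw] with y h1; rw [h1])
  clear hsw
  induction hw using Submodule.span_induction with
  | mem w hw =>
    obtain ⟨f, hf, g, hg, rfl⟩ := hw
    simpa using W.smul' hf (hG g hg)
  | zero => simpa using W.zero' y₀
  | add v w _ _ h1 h2 => simpa using W.add' h1 h2
  | smul c w _ h => simpa using W.const_smul' c h

end GenAt

/-- The tensor product `V ⊗ W`. -/
def tensor (V W : HolSheaf I Y) : HolSheaf I Y where
  fib y := V.fib y ⊗[ℂ] W.fib y
  HolAt s y₀ := GenAt I {g : ∀ y, V.fib y ⊗[ℂ] W.fib y | ∃ (v : ∀ y, V.fib y) (w : ∀ y, W.fib y),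
    V.HolAt v y₀ ∧ W.HolAt w y₀ ∧ g = fun y => v y ⊗ₜ[ℂ] w y} s y₀
  congr' hs h := GenAt.congr hs h
  zero' y₀ := GenAt.zero _ y₀
  add' hs ht := GenAt.add hs ht
  smul' hf hs := GenAt.smul hf hs

/-- The pull-back `φ^*V = 𝒪_Y ⊗ φ^{-1}V` along a map `φ : Y → Z`. -/
def pullback {E' : Type u} [NormedAddCommGroup E'] [NormedSpace ℂ E'] {H' : Type u}
    [TopologicalSpace H'] {I' : ModelWithCorners ℂ E' H'} {Z : Type u} [TopologicalSpace Z]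
    [ChartedSpace H' Z] (I : ModelWithCorners ℂ E H) (V : HolSheaf I' Z) (φ : Y → Z) :
    HolSheaf I Y where
  fib y := V.fib (φ y)
  HolAt s y₀ := GenAt I {g : ∀ y, V.fib (φ y) | ∃ t : ∀ z, V.fib z, V.HolAt t (φ y₀) ∧
    g = fun y => t (φ y)} s y₀
  congr' hs h := GenAt.congr hs h
  zero' y₀ := GenAt.zero _ y₀
  add' hs ht := GenAt.add hs ht
  smul' hf hs := GenAt.smul hf hs

/-- The generators of the exterior algebra of `V` at `y₀`: holomorphic functions and holomorphic
sections of `V`. -/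
def extGen (V : HolSheaf I Y) (y₀ : Y) : Set (∀ y, ExteriorAlgebra ℂ (V.fib y)) :=
  {g | (∃ f : Y → ℂ, HolFunAt I f y₀ ∧ g = fun y => algebraMap ℂ _ (f y)) ∨
    ∃ v : ∀ y, V.fib y, V.HolAt v y₀ ∧ g = fun y => ExteriorAlgebra.ι ℂ (v y)}

/-- The sheaf of algebras `∧^• V`: its holomorphic germs are those generated, as an algebra, by
holomorphic functions and holomorphic sections of `V`. -/
def ext (V : HolSheaf I Y) : HolSheaf I Y where
  fib y := ExteriorAlgebra ℂ (V.fib y)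
  HolAt s y₀ := ∃ w ∈ Algebra.adjoin ℂ (V.extGen y₀), ∀ᶠ y in 𝓝 y₀, s y = w y
  congr' := by
    rintro s t y₀ ⟨w, hw, hs⟩ h
    exact ⟨w, hw, by filter_upwards [h, hs] with y h1 h2; rw [← h1, h2]⟩
  zero' y₀ := ⟨0, Subalgebra.zero_mem _, by simp⟩
  add' := by
    rintro s t y₀ ⟨w, hw, hs⟩ ⟨w', hw', ht⟩
    exact ⟨w + w', Subalgebra.add_mem _ hw hw', by
      filter_upwards [hs, ht] with y h1 h2; rw [h1, h2]; rfl⟩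
  smul' := by
    rintro f s y₀ hf ⟨w, hw, hs⟩
    refine ⟨(fun y => algebraMap ℂ _ (f y)) * w,
      Subalgebra.mul_mem _ (Algebra.subset_adjoin (Or.inl ⟨f, hf, rfl⟩)) hw, ?_⟩
    filter_upwards [hs] with y h1
    rw [h1, Algebra.smul_def]; rfl

theorem ext_mul (V : HolSheaf I Y) {s t : ∀ y, ExteriorAlgebra ℂ (V.fib y)} {y₀ : Y}
    (hs : V.ext.HolAt s y₀) (ht : V.ext.HolAt t y₀) : V.ext.HolAt (fun y => s y * t y) y₀ := by
  obtain ⟨w, hw, hs⟩ := hs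
  obtain ⟨w', hw', ht⟩ := ht
  refine ⟨w * w', Subalgebra.mul_mem _ hw hw', ?_⟩
  filter_upwards [hs, ht] with y h1 h2
  rw [h1, h2]; rfl

theorem ext_ι (V : HolSheaf I Y) {v : ∀ y, V.fib y} {y₀ : Y} (hv : V.HolAt v y₀) :
    V.ext.HolAt (fun y => ExteriorAlgebra.ι ℂ (v y)) y₀ :=
  ⟨_, Algebra.subset_adjoin (Or.inr ⟨v, hv, rfl⟩), by simp⟩

theorem ext_algebraMap (V : HolSheaf I Y) {f : Y → ℂ} {y₀ : Y} (hf : HolFunAt I f y₀) :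
    V.ext.HolAt (fun y => algebraMap ℂ (ExteriorAlgebra ℂ (V.fib y)) (f y)) y₀ :=
  ⟨_, Algebra.subset_adjoin (Or.inl ⟨f, hf, rfl⟩), by simp⟩

/-- The functoriality of `∧^•` preserves holomorphic germs. -/
theorem ext_map {V W : HolSheaf I Y} (φ : Hom V W) {s : ∀ y, ExteriorAlgebra ℂ (V.fib y)}
    {y₀ : Y} (hs : V.ext.HolAt s y₀) :
    W.ext.HolAt (fun y => ExteriorAlgebra.map (φ.app y) (s y)) y₀ := by
  obtain ⟨w, hw, hs⟩ := hs
  suffices W.ext.HolAt (fun y => ExteriorAlgebra.map (φ.app y) (w y)) y₀ from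
    W.ext.congr' this (by filter_upwards [hs] with y h1; rw [h1])
  clear hs
  induction hw using Algebra.adjoin_induction with
  | mem w hw =>
    obtain ⟨f, hf, rfl⟩ | ⟨v, hv, rfl⟩ := hw
    · simpa using W.ext_algebraMap hf
    · simpa using W.ext_ι (φ.hol hv)
  | algebraMap c =>
    have := W.ext_algebraMap (f := fun _ => c) (y₀ := y₀) contMDiffAt_const
    exact W.ext.congr' this (Filter.Eventually.of_forall fun y =>
      ((ExteriorAlgebra.map (φ.app y)).commutes c).symm)
  | add v w _ _ h1 h2 =>
    exact W.ext.congr' (W.ext.add' h1 h2) (Filter.Eventually.of_forall fun y =>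
      (map_add (ExteriorAlgebra.map (φ.app y)) (v y) (w y)).symm)
  | mul v w _ _ h1 h2 =>
    exact W.ext.congr' (W.ext_mul h1 h2) (Filter.Eventually.of_forall fun y =>
      (map_mul (ExteriorAlgebra.map (φ.app y)) (v y) (w y)).symm)

/-- The exterior power `∧^n V`, a subsheaf of `∧^• V`. -/
def extPow (V : HolSheaf I Y) (n : ℕ) : HolSheaf I Y where
  fib y := ⋀[ℂ]^n (V.fib y)
  HolAt s y₀ := V.ext.HolAt (fun y => (s y : ExteriorAlgebra ℂ (V.fib y))) y₀
  congr' hs h := V.ext.congr' hs (by filter_upwards [h] with y h1; rw [h1])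
  zero' := V.ext.zero'
  add' := V.ext.add'
  smul' := V.ext.smul'

end Constructions

end HolSheaf

/-! ### Čech cohomology -/

section Cech

/-- An open cover of `Y` indexed by the points of `Y`, the `y`-th member containing `y`. Such covers
are cofinal among all open covers, and refinement is pointwise inclusion. -/
structure PCover (Y : Type u) [TopologicalSpace Y] where
  set : Y → Opens Y
  mem : ∀ y, y ∈ set y

namespace PCover

variable {Y : Type u} [TopologicalSpace Y]

/-- `U ≤ W` when `W` refines `U`. -/
instance : Preorder (PCover Y) where
  le U W := ∀ y, W.set y ≤ U.set y
  le_refl U y := le_rfl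
  le_trans U V W h h' y := (h' y).trans (h y)

/-- The common refinement by intersections. -/
def inf (U W : PCover Y) : PCover Y := ⟨fun y => U.set y ⊓ W.set y, fun y => ⟨U.mem y, W.mem y⟩⟩

theorem le_inf_left (U W : PCover Y) : U ≤ U.inf W := fun _ => inf_le_left

theorem le_inf_right (U W : PCover Y) : W ≤ U.inf W := fun _ => inf_le_right

theorem inf_mono {U U' W W' : PCover Y} (h : U ≤ U') (h' : W ≤ W') : U.inf W ≤ U'.inf W' :=
  fun y => inf_le_inf (h y) (h' y)

instance : IsDirectedOrder (PCover Y) := ⟨fun U W => ⟨U.inf W, U.le_inf_left W, U.le_inf_right W⟩⟩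

instance : Nonempty (PCover Y) := ⟨⟨fun _ => ⊤, fun _ => trivial⟩⟩

instance : DecidableEq (PCover Y) := Classical.decEq _

/-- The intersection `U_{i₀} ∩ ⋯ ∩ U_{iₙ}`. -/
def inter (U : PCover Y) {n : ℕ} (i : Fin (n + 1) → Y) : Opens Y :=
  ⟨⋂ k, (U.set (i k) : Set Y), isOpen_iInter_of_finite fun k => (U.set (i k)).isOpen⟩

theorem mem_inter {U : PCover Y} {n : ℕ} {i : Fin (n + 1) → Y} {y : Y} :
    y ∈ U.inter i ↔ ∀ k, y ∈ U.set (i k) := by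
  change y ∈ ⋂ k, (U.set (i k) : Set Y) ↔ _
  simp

theorem inter_comp_le (U : PCover Y) {n m : ℕ} (i : Fin (n + 1) → Y)
    (f : Fin (m + 1) → Fin (n + 1)) : U.inter i ≤ U.inter (i ∘ f) := fun _ hy =>
  mem_inter.2 fun k => mem_inter.1 hy (f k)

theorem inter_mono {U W : PCover Y} (h : U ≤ W) {n : ℕ} (i : Fin (n + 1) → Y) :
    W.inter i ≤ U.inter i := fun _ hy => mem_inter.2 fun k => h _ (mem_inter.1 hy k)

end PCover

namespace HolSheaf

variable {E : Type u} [NormedAddCommGroup E] [NormedSpace ℂ E]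
  {H : Type u} [TopologicalSpace H] {I : ModelWithCorners ℂ E H}
  {Y : Type u} [TopologicalSpace Y] [ChartedSpace H Y]

/-- Čech `n`-cochains of the cover `U` with values in `V`. -/
def Cochain (V : HolSheaf I Y) (U : PCover Y) (n : ℕ) : Type u :=
  ∀ i : Fin (n + 1) → Y, V.sections (U.inter i)

instance (V : HolSheaf I Y) (U : PCover Y) (n : ℕ) : AddCommGroup (V.Cochain U n) :=
  inferInstanceAs (AddCommGroup (∀ i : Fin (n + 1) → Y, V.sections (U.inter i)))

instance (V : HolSheaf I Y) (U : PCover Y) (n : ℕ) : Module ℂ (V.Cochain U n) :=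
  inferInstanceAs (Module ℂ (∀ i : Fin (n + 1) → Y, V.sections (U.inter i)))

/-- The Čech differential `(δc)_{i₀⋯iₙ₊₁} = ∑ₖ (-1)ᵏ c_{i₀⋯îₖ⋯iₙ₊₁}`. -/
def δ (V : HolSheaf I Y) (U : PCover Y) (n : ℕ) : V.Cochain U n →ₗ[ℂ] V.Cochain U (n + 1) where
  toFun c i := ∑ k : Fin (n + 2), (-1 : ℂ) ^ (k : ℕ) •
    V.res (U.inter_comp_le i k.succAbove) (c (i ∘ k.succAbove))
  map_add' c d := by
    funext i
    change ∑ k : Fin (n + 2), (-1 : ℂ) ^ (k : ℕ) • V.res (U.inter_comp_le i k.succAbove)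
      (c (i ∘ k.succAbove) + d (i ∘ k.succAbove)) = _
    simp only [map_add, smul_add, Finset.sum_add_distrib]
    rfl
  map_smul' a c := by
    funext i
    change ∑ k : Fin (n + 2), (-1 : ℂ) ^ (k : ℕ) • V.res (U.inter_comp_le i k.succAbove)
      (a • c (i ∘ k.succAbove)) = a • ∑ k : Fin (n + 2), _
    simp only [map_smul, Finset.smul_sum]
    exact Finset.sum_congr rfl fun k _ => smul_comm _ _ _

/-- Čech cocycles. -/
def Cocycle (V : HolSheaf I Y) (U : PCover Y) (n : ℕ) : Submodule ℂ (V.Cochain U n) :=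
  LinearMap.ker (V.δ U n)

/-- Čech coboundaries. -/
def Coboundary (V : HolSheaf I Y) (U : PCover Y) : ∀ n : ℕ, Submodule ℂ (V.Cochain U n)
  | 0 => ⊥
  | n + 1 => LinearMap.range (V.δ U n)

theorem mem_coboundary_succ (V : HolSheaf I Y) {U : PCover Y} {n : ℕ} {c : V.Cochain U (n + 1)} :
    c ∈ V.Coboundary U (n + 1) ↔ ∃ b, V.δ U n b = c := Iff.rfl

/-- Čech cohomology `Ȟⁿ(U, V)` of a cover. -/
abbrev HCover (V : HolSheaf I Y) (n : ℕ) (U : PCover Y) : Type u :=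
  V.Cocycle U n ⧸ (V.Coboundary U n).comap (V.Cocycle U n).subtype

/-- Restriction of cochains to a refinement. -/
def refineCochain (V : HolSheaf I Y) {U W : PCover Y} (h : U ≤ W) (n : ℕ) :
    V.Cochain U n →ₗ[ℂ] V.Cochain W n where
  toFun c i := V.res (PCover.inter_mono h i) (c i)
  map_add' _ _ := rfl
  map_smul' _ _ := rfl

theorem refineCochain_δ (V : HolSheaf I Y) {U W : PCover Y} (h : U ≤ W) (n : ℕ)
    (c : V.Cochain U n) :
    V.refineCochain h (n + 1) (V.δ U n c) = V.δ W n (V.refineCochain h n c) := by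
  funext i
  change V.res (PCover.inter_mono h i) (∑ k : Fin (n + 2), _) = ∑ k : Fin (n + 2), _
  rw [map_sum]
  exact Finset.sum_congr rfl fun k _ => by rw [map_smul]; rfl

/-- The refinement maps `Ȟⁿ(U, V) → Ȟⁿ(W, V)`. -/
def refine (V : HolSheaf I Y) (n : ℕ) (U W : PCover Y) (h : U ≤ W) :
    V.HCover n U →ₗ[ℂ] V.HCover n W :=
  Submodule.mapQ _ _ ((V.refineCochain h n).restrict (p := V.Cocycle U n) (q := V.Cocycle W n)
    (fun c hc => by
      rw [Cocycle, LinearMap.mem_ker] at hc ⊢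
      rw [← refineCochain_δ, hc, map_zero])) (by
    rintro ⟨c, hc⟩ h'
    cases n with
    | zero =>
      have h'' : c = 0 := h'
      subst h''
      change V.refineCochain h 0 0 = 0
      exact map_zero _
    | succ n =>
      obtain ⟨b, hb⟩ := h'
      exact ⟨V.refineCochain h n b, by rw [← refineCochain_δ, hb]; rfl⟩)

/-- The Čech cohomology `Hⁿ(Y, V)`: the direct limit of `Ȟⁿ(U, V)` over the open covers `U`. -/
def Coh (V : HolSheaf I Y) (n : ℕ) : Type u :=
  Module.DirectLimit (V.HCover n) (V.refine n)

instance (V : HolSheaf I Y) (n : ℕ) : AddCommGroup (V.Coh n) :=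
  Module.DirectLimit.addCommGroup (V.HCover n) (V.refine n)

instance (V : HolSheaf I Y) (n : ℕ) : Module ℂ (V.Coh n) :=
  Module.DirectLimit.module (V.HCover n) (V.refine n)

/-- The canonical map `Ȟⁿ(U, V) → Hⁿ(Y, V)`. -/
def cohOf (V : HolSheaf I Y) (n : ℕ) (U : PCover Y) : V.HCover n U →ₗ[ℂ] V.Coh n :=
  Module.DirectLimit.of ℂ (PCover Y) (V.HCover n) (V.refine n) U

/-- The class in `Hⁿ(Y, V)` of a Čech cocycle. -/
def cls (V : HolSheaf I Y) {n : ℕ} {U : PCover Y} : V.Cocycle U n →ₗ[ℂ] V.Coh n :=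
  (V.cohOf n U).comp
    (Submodule.mkQ ((V.Coboundary U n).comap (V.Cocycle U n).subtype))

/-- Restriction of cocycles to a refinement. -/
def refineCocycle (V : HolSheaf I Y) {U W : PCover Y} (h : U ≤ W) (n : ℕ) (c : V.Cocycle U n) :
    V.Cocycle W n :=
  ⟨V.refineCochain h n c.1, by
    rw [Cocycle, LinearMap.mem_ker, ← refineCochain_δ, show V.δ U n c.1 = 0 from c.2, map_zero]⟩

theorem refineCocycle_rfl (V : HolSheaf I Y) {U : PCover Y} (h : U ≤ U) (n : ℕ)
    (c : V.Cocycle U n) : V.refineCocycle h n c = c := rfl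

theorem cls_refine (V : HolSheaf I Y) {n : ℕ} {U W : PCover Y} (h : U ≤ W) (c : V.Cocycle U n)
    (d : V.Cocycle W n) (hd : d.1 = V.refineCochain h n c.1) : V.cls d = V.cls c := by
  obtain ⟨d, hd'⟩ := d
  obtain rfl := hd
  exact Module.DirectLimit.of_f (G := V.HCover n) (f := V.refine n) (hij := h)
    (x := Submodule.Quotient.mk c)

theorem exists_cls (V : HolSheaf I Y) {n : ℕ} (w : V.Coh n) :
    ∃ (U : PCover Y) (c : V.Cocycle U n), V.cls c = w := by
  obtain ⟨U, x, rfl⟩ := Module.DirectLimit.exists_of w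
  obtain ⟨c, rfl⟩ := Submodule.Quotient.mk_surjective _ x
  exact ⟨U, c, rfl⟩

theorem coh_ext (V : HolSheaf I Y) {n : ℕ} {M : Type*} [AddCommMonoid M] [Module ℂ M]
    {f g : V.Coh n →ₗ[ℂ] M} (h : ∀ (U : PCover Y) (c : V.Cocycle U n), f (V.cls c) = g (V.cls c)) :
    f = g := by
  ext w
  obtain ⟨U, c, rfl⟩ := V.exists_cls w
  exact h U c

/-- A linear map out of cohomology from compatible linear maps on cocycles. -/
def liftCoh (V : HolSheaf I Y) {n : ℕ} {M : Type*} [AddCommGroup M] [Module ℂ M]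
    (f : ∀ U : PCover Y, V.Cocycle U n →ₗ[ℂ] M)
    (h0 : ∀ U (c : V.Cocycle U n), c.1 ∈ V.Coboundary U n → f U c = 0)
    (hr : ∀ U W (h : U ≤ W) (c : V.Cocycle U n), f W (V.refineCocycle h n c) = f U c) :
    V.Coh n →ₗ[ℂ] M :=
  Module.DirectLimit.lift ℂ (PCover Y) (V.HCover n) (V.refine n)
    (fun U => Submodule.liftQ _ (f U) fun c hc => h0 U c hc)
    (fun U W h x => by
      obtain ⟨c, rfl⟩ := Submodule.Quotient.mk_surjective _ x
      exact hr U W h c)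

theorem liftCoh_cls (V : HolSheaf I Y) {n : ℕ} {M : Type*} [AddCommGroup M] [Module ℂ M]
    (f : ∀ U : PCover Y, V.Cocycle U n →ₗ[ℂ] M)
    (h0 : ∀ U (c : V.Cocycle U n), c.1 ∈ V.Coboundary U n → f U c = 0)
    (hr : ∀ U W (h : U ≤ W) (c : V.Cocycle U n), f W (V.refineCocycle h n c) = f U c)
    {U : PCover Y} (c : V.Cocycle U n) : V.liftCoh f h0 hr (V.cls c) = f U c := by
  exact Module.DirectLimit.lift_of (f := V.refine n) _ _ _

theorem cls_eq_zero (V : HolSheaf I Y) {n : ℕ} {U : PCover Y} (c : V.Cocycle U (n + 1))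
    (b : V.Cochain U n) (h : c.1 = V.δ U n b) : V.cls c = 0 := by
  have : Submodule.mkQ ((V.Coboundary U (n + 1)).comap (V.Cocycle U (n + 1)).subtype) c = 0 := by
    rw [Submodule.mkQ_apply, Submodule.Quotient.mk_eq_zero]
    exact ⟨b, h.symm⟩
  rw [cls, LinearMap.comp_apply, this, map_zero]

/-- The map of cochains induced by a morphism of sheaves. -/
def Hom.cochain {V W : HolSheaf I Y} (φ : Hom V W) (U : PCover Y) (n : ℕ) :
    V.Cochain U n →ₗ[ℂ] W.Cochain U n where
  toFun c i := ⟨fun y => φ.app y ((c i).1 y), φ.mem_sections (c i).2⟩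
  map_add' c d := by
    funext i
    ext y
    exact map_add (φ.app y) _ _
  map_smul' a c := by
    funext i
    ext y
    exact map_smul (φ.app y) _ _

theorem coe_sum_apply (V : HolSheaf I Y) {U : Opens Y} {ι : Type*} (t : Finset ι)
    (s : ι → V.sections U) (y : U) : (∑ k ∈ t, s k).1 y = ∑ k ∈ t, (s k).1 y := by
  rw [AddSubmonoidClass.coe_finsetSum, Finset.sum_apply]

theorem δ_apply (V : HolSheaf I Y) {U : PCover Y} {n : ℕ} (c : V.Cochain U n)
    (i : Fin (n + 2) → Y) (y : U.inter i) :
    (V.δ U n c i).1 y = ∑ k : Fin (n + 2), (-1 : ℂ) ^ (k : ℕ) •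
      (c (i ∘ k.succAbove)).1 ⟨y, U.inter_comp_le i k.succAbove y.2⟩ :=
  V.coe_sum_apply _ _ _

theorem Hom.cochain_δ {V W : HolSheaf I Y} (φ : Hom V W) (U : PCover Y) (n : ℕ)
    (c : V.Cochain U n) : φ.cochain U (n + 1) (V.δ U n c) = W.δ U n (φ.cochain U n c) := by
  funext i
  ext y
  rw [δ_apply]
  change φ.app y ((V.δ U n c i).1 y) = _
  rw [δ_apply, map_sum]
  exact Finset.sum_congr rfl fun k _ => map_smul (φ.app y) _ _

/-- The map of cocycles induced by a morphism of sheaves. -/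
def Hom.cocycle {V W : HolSheaf I Y} (φ : Hom V W) (U : PCover Y) (n : ℕ) :
    V.Cocycle U n →ₗ[ℂ] W.Cocycle U n :=
  (φ.cochain U n).restrict fun c hc => by
    rw [Cocycle, LinearMap.mem_ker] at hc ⊢
    rw [← φ.cochain_δ, hc, map_zero]

theorem Hom.cocycle_coboundary {V W : HolSheaf I Y} (φ : Hom V W) (U : PCover Y) (n : ℕ)
    (c : V.Cocycle U n) (hc : c.1 ∈ V.Coboundary U n) : W.cls (φ.cocycle U n c) = 0 := by
  cases n with
  | zero =>
    have : c = 0 := Subtype.ext hc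
    rw [this, map_zero, map_zero]
  | succ n =>
    obtain ⟨b, hb⟩ := hc
    exact W.cls_eq_zero _ (φ.cochain U n b) (by rw [← φ.cochain_δ, hb]; rfl)

/-- The map `Hⁿ(Y, V) → Hⁿ(Y, W)` induced by a morphism of sheaves. -/
def Hom.coh {V W : HolSheaf I Y} (φ : Hom V W) (n : ℕ) : V.Coh n →ₗ[ℂ] W.Coh n :=
  V.liftCoh (M := W.Coh n) (fun U => W.cls.comp (φ.cocycle U n))
    (fun U c hc => φ.cocycle_coboundary U n c hc)
    (fun _ _ h _ => W.cls_refine h _ _ rfl)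

theorem Hom.coh_cls {V W : HolSheaf I Y} (φ : Hom V W) {n : ℕ} {U : PCover Y}
    (c : V.Cocycle U n) : φ.coh n (V.cls c) = W.cls (φ.cocycle U n c) :=
  V.liftCoh_cls (fun U => W.cls.comp (φ.cocycle U n)) _ _ c

/-- The value of a cochain, extended by zero. -/
def ev (V : HolSheaf I Y) {U : PCover Y} {n : ℕ} (c : V.Cochain U n) (i : Fin (n + 1) → Y) (y : Y) :
    V.fib y := V.extZero (U.inter i) (c i).1 y

theorem ev_mem (V : HolSheaf I Y) {U : PCover Y} {n : ℕ} (c : V.Cochain U n) (i : Fin (n + 1) → Y)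
    {y : Y} (hy : y ∈ U.inter i) : V.ev c i y = (c i).1 ⟨y, hy⟩ := V.extZero_of_mem _ hy

theorem ev_δ (V : HolSheaf I Y) {U : PCover Y} {n : ℕ} (c : V.Cochain U n)
    (i : Fin (n + 2) → Y) {y : Y} (hy : y ∈ U.inter i) :
    V.ev (V.δ U n c) i y =
      ∑ k : Fin (n + 2), (-1 : ℂ) ^ (k : ℕ) • V.ev c (i ∘ k.succAbove) y := by
  rw [ev_mem _ _ _ hy, δ_apply]
  exact Finset.sum_congr rfl fun k _ => by
    rw [ev_mem _ _ _ (U.inter_comp_le i k.succAbove hy)]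

theorem ev_δ₀ (V : HolSheaf I Y) {U : PCover Y} (c : V.Cochain U 0) (i : Fin 2 → Y)
    {y : Y} (hy : y ∈ U.inter i) :
    V.ev (V.δ U 0 c) i y = V.ev c ![i 1] y - V.ev c ![i 0] y := by
  rw [ev_δ _ _ _ hy, Fin.sum_univ_two]
  have h0 : i ∘ (0 : Fin 2).succAbove = ![i 1] := by
    ext k; fin_cases k; rfl
  have h1 : i ∘ (1 : Fin 2).succAbove = ![i 0] := by
    ext k; fin_cases k; rfl
  rw [h0, h1]
  simp [sub_eq_add_neg]

theorem ev_δ₁ (V : HolSheaf I Y) {U : PCover Y} (c : V.Cochain U 1) (i : Fin 3 → Y)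
    {y : Y} (hy : y ∈ U.inter i) :
    V.ev (V.δ U 1 c) i y = V.ev c ![i 1, i 2] y - V.ev c ![i 0, i 2] y + V.ev c ![i 0, i 1] y := by
  rw [ev_δ _ _ _ hy, Fin.sum_univ_three]
  have h0 : i ∘ (0 : Fin 3).succAbove = ![i 1, i 2] := by
    ext k; fin_cases k <;> rfl
  have h1 : i ∘ (1 : Fin 3).succAbove = ![i 0, i 2] := by
    ext k; fin_cases k <;> rfl
  have h2 : i ∘ (2 : Fin 3).succAbove = ![i 0, i 1] := by
    ext k; fin_cases k <;> rfl
  rw [h0, h1, h2]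
  simp [sub_eq_add_neg]

theorem ev_δ₂ (V : HolSheaf I Y) {U : PCover Y} (c : V.Cochain U 2) (i : Fin 4 → Y)
    {y : Y} (hy : y ∈ U.inter i) :
    V.ev (V.δ U 2 c) i y = V.ev c ![i 1, i 2, i 3] y - V.ev c ![i 0, i 2, i 3] y
      + V.ev c ![i 0, i 1, i 3] y - V.ev c ![i 0, i 1, i 2] y := by
  rw [ev_δ _ _ _ hy, Fin.sum_univ_four]
  have h0 : i ∘ (0 : Fin 4).succAbove = ![i 1, i 2, i 3] := by
    ext k; fin_cases k <;> rfl
  have h1 : i ∘ (1 : Fin 4).succAbove = ![i 0, i 2, i 3] := by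
    ext k; fin_cases k <;> rfl
  have h2 : i ∘ (2 : Fin 4).succAbove = ![i 0, i 1, i 3] := by
    ext k; fin_cases k <;> rfl
  have h3 : i ∘ (3 : Fin 4).succAbove = ![i 0, i 1, i 2] := by
    ext k; fin_cases k <;> rfl
  rw [h0, h1, h2, h3]
  simp [sub_eq_add_neg, pow_succ]

theorem cochain_ext (V : HolSheaf I Y) {U : PCover Y} {n : ℕ} {c d : V.Cochain U n}
    (h : ∀ i, ∀ y ∈ U.inter i, V.ev c i y = V.ev d i y) : c = d := by
  funext i
  ext y
  have := h i y y.2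
  rwa [ev_mem _ _ _ y.2, ev_mem _ _ _ y.2] at this

theorem cocycle₁ (V : HolSheaf I Y) {U : PCover Y} (c : V.Cocycle U 1) {x y z p : Y}
    (hx : p ∈ U.set x) (hy : p ∈ U.set y) (hz : p ∈ U.set z) :
    V.ev c.1 ![x, z] p = V.ev c.1 ![x, y] p + V.ev c.1 ![y, z] p := by
  have hp : p ∈ U.inter ![x, y, z] := PCover.mem_inter.2 fun k => by
    fin_cases k <;> assumption
  have h := V.ev_δ₁ c.1 ![x, y, z] hp
  have h0 : V.δ U 1 c.1 = 0 := c.2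
  rw [h0] at h
  have h1 : V.ev (0 : V.Cochain U 2) ![x, y, z] p = 0 := by
    rw [ev_mem _ _ _ hp]; rfl
  rw [h1] at h
  simp only [Matrix.cons_val] at h
  rw [eq_comm, ← sub_eq_zero]
  rw [h]
  abel

/-! The cup product of degree one classes. -/

/-- The product cochain `(i₀, …, iₚ) ↦ a_{i_{f 0} i_{f 1} ⋯} · b_{i_{g 0} i_{g 1} ⋯}`. -/
def Pairing.prodCochain {V W P : HolSheaf I Y} (β : Pairing V W P) {U : PCover Y} {n m p : ℕ}
    (f : Fin (n + 1) → Fin (p + 1)) (g : Fin (m + 1) → Fin (p + 1))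
    (a : V.Cochain U n) (b : W.Cochain U m) : P.Cochain U p := fun i =>
  ⟨fun y => β.app y ((a (i ∘ f)).1 ⟨y, U.inter_comp_le i f y.2⟩)
      ((b (i ∘ g)).1 ⟨y, U.inter_comp_le i g y.2⟩),
    β.mem_sections (V.sections_res (U.inter_comp_le i f) (a (i ∘ f)).2)
      (W.sections_res (U.inter_comp_le i g) (b (i ∘ g)).2)⟩

theorem Pairing.ev_prodCochain {V W P : HolSheaf I Y} (β : Pairing V W P) {U : PCover Y}
    {n m p : ℕ} (f : Fin (n + 1) → Fin (p + 1)) (g : Fin (m + 1) → Fin (p + 1))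
    (a : V.Cochain U n) (b : W.Cochain U m) (i : Fin (p + 1) → Y) {y : Y} (hy : y ∈ U.inter i) :
    P.ev (β.prodCochain f g a b) i y = β.app y (V.ev a (i ∘ f) y) (W.ev b (i ∘ g) y) := by
  rw [ev_mem _ _ _ hy, ev_mem _ _ _ (U.inter_comp_le i f hy),
    ev_mem _ _ _ (U.inter_comp_le i g hy)]
  rfl

/-- `(a ∪ b)_{ijk} = a_{ij} · b_{jk}`. -/
def Pairing.cupCochain {V W P : HolSheaf I Y} (β : Pairing V W P) {U : PCover Y}
    (a : V.Cochain U 1) (b : W.Cochain U 1) : P.Cochain U 2 :=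
  β.prodCochain ![0, 1] ![1, 2] a b

theorem Pairing.ev_cupCochain {V W P : HolSheaf I Y} (β : Pairing V W P) {U : PCover Y}
    (a : V.Cochain U 1) (b : W.Cochain U 1) (i : Fin 3 → Y) {y : Y} (hy : y ∈ U.inter i) :
    P.ev (β.cupCochain a b) i y =
      β.app y (V.ev a ![i 0, i 1] y) (W.ev b ![i 1, i 2] y) := by
  have h0 : i ∘ ![0, 1] = ![i 0, i 1] := by
    ext k; fin_cases k <;> rfl
  have h1 : i ∘ ![1, 2] = ![i 1, i 2] := by
    ext k; fin_cases k <;> rfl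
  rw [cupCochain, β.ev_prodCochain _ _ _ _ _ hy, h0, h1]

theorem Pairing.cupCochain_mem {V W P : HolSheaf I Y} (β : Pairing V W P) {U : PCover Y}
    (a : V.Cocycle U 1) (b : W.Cocycle U 1) : β.cupCochain a.1 b.1 ∈ P.Cocycle U 2 := by
  rw [Cocycle, LinearMap.mem_ker]
  refine P.cochain_ext fun i y hy => ?_
  have hk : ∀ k, y ∈ U.set (i k) := PCover.mem_inter.1 hy
  have hm : ∀ j k l : Fin 4, y ∈ U.inter ![i j, i k, i l] := fun j k l =>
    PCover.mem_inter.2 fun m => by fin_cases m <;> apply hk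
  rw [ev_δ₂ _ _ _ hy, β.ev_cupCochain _ _ _ (hm 1 2 3), β.ev_cupCochain _ _ _ (hm 0 2 3),
    β.ev_cupCochain _ _ _ (hm 0 1 3), β.ev_cupCochain _ _ _ (hm 0 1 2), ev_mem _ _ _ hy]
  simp only [Matrix.cons_val]
  rw [V.cocycle₁ a (hk 0) (hk 1) (hk 2), W.cocycle₁ b (hk 1) (hk 2) (hk 3)]
  simp only [map_add, LinearMap.add_apply]
  change _ = (0 : P.fib y)
  abel

/-- The class in `H²(Y, P)` of the cup product of two degree one cocycles. -/
def Pairing.cupCls {V W P : HolSheaf I Y} (β : Pairing V W P) (U U' : PCover Y) :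
    V.Cocycle U 1 →ₗ[ℂ] W.Cocycle U' 1 →ₗ[ℂ] P.Coh 2 :=
  LinearMap.mk₂ ℂ (fun a b => P.cls (U := U.inf U')
      ⟨_, β.cupCochain_mem (V.refineCocycle (U.le_inf_left U') 1 a)
        (W.refineCocycle (U.le_inf_right U') 1 b)⟩)
    (fun a a' b => by
      rw [← map_add]
      refine congrArg _ (Subtype.ext (funext fun i => Subtype.ext (funext fun y => ?_)))
      exact LinearMap.map_add₂ (β.app y) _ _ _)
    (fun c a b => by
      rw [← map_smul]
      refine congrArg _ (Subtype.ext (funext fun i => Subtype.ext (funext fun y => ?_)))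
      exact LinearMap.map_smul₂ (β.app y) _ _ _)
    (fun a b b' => by
      rw [← map_add]
      refine congrArg _ (Subtype.ext (funext fun i => Subtype.ext (funext fun y => ?_)))
      exact map_add (β.app y _) _ _)
    (fun c a b => by
      rw [← map_smul]
      refine congrArg _ (Subtype.ext (funext fun i => Subtype.ext (funext fun y => ?_)))
      exact map_smul (β.app y _) _ _)

theorem Pairing.cupCls_refine {V W P : HolSheaf I Y} (β : Pairing V W P) {U U₁ U' U₁' : PCover Y}
    (h : U ≤ U₁) (h' : U' ≤ U₁') (a : V.Cocycle U 1) (b : W.Cocycle U' 1) :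
    β.cupCls U₁ U₁' (V.refineCocycle h 1 a) (W.refineCocycle h' 1 b) = β.cupCls U U' a b :=
  P.cls_refine (PCover.inf_mono h h') _ _ rfl

theorem Pairing.cupCls_coboundary_left {V W P : HolSheaf I Y} (β : Pairing V W P)
    {U U' : PCover Y} (a : V.Cocycle U 1) (b : W.Cocycle U' 1) (α : V.Cochain U 0)
    (h : V.δ U 0 α = a.1) : β.cupCls U U' a b = 0 := by
  set b' := W.refineCocycle (U.le_inf_right U') 1 b with hb'
  set α' := V.refineCochain (U.le_inf_left U') 0 α with hα'
  have ha : (V.refineCocycle (U.le_inf_left U') 1 a).1 = V.δ _ 0 α' := by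
    rw [hα', ← refineCochain_δ, h]; rfl
  refine P.cls_eq_zero _ (β.prodCochain (p := 1) ![0] ![0, 1] α' b'.1) ?_
  refine P.cochain_ext fun i y hy => ?_
  have hk : ∀ k, y ∈ (U.inf U').set (i k) := PCover.mem_inter.1 hy
  have hm : ∀ j k : Fin 3, y ∈ (U.inf U').inter ![i j, i k] := fun j k =>
    PCover.mem_inter.2 fun m => by fin_cases m <;> apply hk
  have e0 : ∀ x z : Y, ![x, z] ∘ ![(0 : Fin 2)] = ![x] := fun x z => by
    ext k; fin_cases k; rfl
  have e1 : ∀ x z : Y, ![x, z] ∘ ![(0 : Fin 2), 1] = ![x, z] := fun x z => by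
    ext k; fin_cases k <;> rfl
  change P.ev (β.cupCochain (V.refineCocycle (U.le_inf_left U') 1 a).1 b'.1) i y = _
  rw [ha, β.ev_cupCochain _ _ _ hy, ev_δ₁ _ _ _ hy, β.ev_prodCochain _ _ _ _ _ (hm 1 2),
    β.ev_prodCochain _ _ _ _ _ (hm 0 2), β.ev_prodCochain _ _ _ _ _ (hm 0 1),
    ev_δ₀ _ _ _ (hm 0 1), e0, e0, e0, e1, e1, e1, W.cocycle₁ b' (hk 0) (hk 1) (hk 2)]
  simp only [Matrix.cons_val, map_add, map_sub, LinearMap.sub_apply]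
  abel

theorem Pairing.cupCls_coboundary_right {V W P : HolSheaf I Y} (β : Pairing V W P)
    {U U' : PCover Y} (a : V.Cocycle U 1) (b : W.Cocycle U' 1) (α : W.Cochain U' 0)
    (h : W.δ U' 0 α = b.1) : β.cupCls U U' a b = 0 := by
  set a' := V.refineCocycle (U.le_inf_left U') 1 a with ha'
  set α' := W.refineCochain (U.le_inf_right U') 0 α with hα'
  have hb : (W.refineCocycle (U.le_inf_right U') 1 b).1 = W.δ _ 0 α' := by
    rw [hα', ← refineCochain_δ, h]; rfl
  rw [← neg_eq_zero]
  refine (map_neg P.cls _).symm.trans (P.cls_eq_zero _ (β.prodCochain (p := 1) ![0, 1] ![1] a'.1 α') ?_)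
  refine P.cochain_ext fun i y hy => ?_
  have hk : ∀ k, y ∈ (U.inf U').set (i k) := PCover.mem_inter.1 hy
  have hm : ∀ j k : Fin 3, y ∈ (U.inf U').inter ![i j, i k] := fun j k =>
    PCover.mem_inter.2 fun m => by fin_cases m <;> apply hk
  have e0 : ∀ x z : Y, ![x, z] ∘ ![(1 : Fin 2)] = ![z] := fun x z => by
    ext k; fin_cases k; rfl
  have e1 : ∀ x z : Y, ![x, z] ∘ ![(0 : Fin 2), 1] = ![x, z] := fun x z => by
    ext k; fin_cases k <;> rfl
  have hneg : P.ev (-(β.cupCochain a'.1 (W.refineCocycle (U.le_inf_right U') 1 b).1)) i y =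
      -P.ev (β.cupCochain a'.1 (W.refineCocycle (U.le_inf_right U') 1 b).1) i y := by
    rw [ev_mem _ _ _ hy, ev_mem _ _ _ hy]; rfl
  change P.ev (-(β.cupCochain a'.1 (W.refineCocycle (U.le_inf_right U') 1 b).1)) i y = _
  rw [hneg, hb, β.ev_cupCochain _ _ _ hy, ev_δ₁ _ _ _ hy, β.ev_prodCochain _ _ _ _ _ (hm 1 2),
    β.ev_prodCochain _ _ _ _ _ (hm 0 2), β.ev_prodCochain _ _ _ _ _ (hm 0 1),
    ev_δ₀ _ _ _ (hm 1 2), e0, e0, e0, e1, e1, e1, V.cocycle₁ a' (hk 0) (hk 1) (hk 2)]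
  simp only [Matrix.cons_val, map_add, map_sub, LinearMap.add_apply]
  abel

/-- Cup product with the class of a fixed cocycle. -/
def Pairing.cupRight {V W P : HolSheaf I Y} (β : Pairing V W P) {U : PCover Y}
    (a : V.Cocycle U 1) : W.Coh 1 →ₗ[ℂ] P.Coh 2 :=
  W.liftCoh (M := P.Coh 2) (fun U' => β.cupCls U U' a)
    (fun _ b h => Exists.elim (W.mem_coboundary_succ.1 h)
      fun α hα => β.cupCls_coboundary_right a b α hα)
    (fun _ _ h b => β.cupCls_refine (le_refl U) h a b)

theorem Pairing.cupRight_cls {V W P : HolSheaf I Y} (β : Pairing V W P) {U U' : PCover Y}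
    (a : V.Cocycle U 1) (b : W.Cocycle U' 1) : β.cupRight a (W.cls b) = β.cupCls U U' a b :=
  W.liftCoh_cls (fun U' => β.cupCls U U' a) _ _ b

/-- The cup product `H¹(Y, V) × H¹(Y, W) → H²(Y, P)` along a pairing `V × W → P`. -/
def Pairing.cup {V W P : HolSheaf I Y} (β : Pairing V W P) :
    V.Coh 1 →ₗ[ℂ] W.Coh 1 →ₗ[ℂ] P.Coh 2 :=
  V.liftCoh (M := W.Coh 1 →ₗ[ℂ] P.Coh 2) (fun U =>
    { toFun := fun a => β.cupRight a
      map_add' := fun a a' => W.coh_ext fun U' b => by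
        rw [LinearMap.add_apply, cupRight_cls, cupRight_cls, cupRight_cls, map_add,
          LinearMap.add_apply]
      map_smul' := fun c a => W.coh_ext fun U' b => by
        rw [RingHom.id_apply, LinearMap.smul_apply, cupRight_cls, cupRight_cls, map_smul,
          LinearMap.smul_apply] })
    (fun U a h => W.coh_ext fun U' b => by
      obtain ⟨α, hα⟩ := V.mem_coboundary_succ.1 h
      exact (β.cupRight_cls a b).trans (β.cupCls_coboundary_left a b α hα))
    (fun U U' h a => W.coh_ext fun U'' b => by
      refine (β.cupRight_cls _ b).trans (Eq.trans ?_ (β.cupRight_cls a b).symm)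
      exact β.cupCls_refine h (le_refl U'') a b)

theorem Pairing.cup_cls {V W P : HolSheaf I Y} (β : Pairing V W P) {U : PCover Y}
    (a : V.Cocycle U 1) (b : W.Cocycle U 1) :
    β.cup (V.cls a) (W.cls b) = P.cls ⟨β.cupCochain a.1 b.1, β.cupCochain_mem a b⟩ := by
  rw [cup, liftCoh_cls]
  refine (β.cupRight_cls a b).trans ?_
  exact P.cls_refine (W := U.inf U) (U.le_inf_left U)
    ⟨β.cupCochain a.1 b.1, β.cupCochain_mem a b⟩ _ rfl

end HolSheaf

end Cech

/-! ### The filtration of the exterior powers of an extension -/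

section Linear

variable {U V W : Type u} [AddCommGroup U] [Module ℂ U] [AddCommGroup V] [Module ℂ V]
  [AddCommGroup W] [Module ℂ W]

theorem ιInv_mul (x y : ExteriorAlgebra ℂ V) :
    ExteriorAlgebra.ιInv (x * y) = ExteriorAlgebra.algebraMapInv x • ExteriorAlgebra.ιInv y +
      ExteriorAlgebra.algebraMapInv y • ExteriorAlgebra.ιInv x := by
  let : Module ℂᵐᵒᵖ V := Module.compHom _ ((RingHom.id ℂ).fromOpposite mul_comm)
  have : IsCentralScalar ℂ V := ⟨fun r m => rfl⟩
  have h : (TrivSqZeroExt.fstHom ℂ ℂ V).comp ExteriorAlgebra.toTrivSqZeroExt =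
      ExteriorAlgebra.algebraMapInv := by
    apply ExteriorAlgebra.hom_ext
    ext m
    simp [ExteriorAlgebra.algebraMapInv]
  have h' : ∀ z : ExteriorAlgebra ℂ V, ExteriorAlgebra.algebraMapInv z =
      (ExteriorAlgebra.toTrivSqZeroExt z).fst := fun z => by rw [← h]; rfl
  rw [h', h']
  change (ExteriorAlgebra.toTrivSqZeroExt (x * y)).snd =
    _ • (ExteriorAlgebra.toTrivSqZeroExt y).snd + _ • (ExteriorAlgebra.toTrivSqZeroExt x).snd
  rw [map_mul, TrivSqZeroExt.snd_mul, op_smul_eq_smul]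

theorem ιInv_algebraMap (c : ℂ) :
    ExteriorAlgebra.ιInv (algebraMap ℂ (ExteriorAlgebra ℂ V) c) = 0 := by
  have h := ιInv_mul (V := V) 1 1
  simp only [mul_one, map_one, one_smul] at h
  rw [Algebra.algebraMap_eq_smul_one, map_smul, left_eq_add.1 h, smul_zero]

theorem extMap_mem (i : U →ₗ[ℂ] V) {k : ℕ} {x : ExteriorAlgebra ℂ U} (hx : x ∈ ⋀[ℂ]^k U) :
    ExteriorAlgebra.map i x ∈ ⋀[ℂ]^k V := by
  have h : (⋀[ℂ]^k U).map (ExteriorAlgebra.map i).toLinearMap ≤ ⋀[ℂ]^k V := by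
    rw [ExteriorAlgebra.exteriorPower, Submodule.map_pow]
    refine pow_le_pow_left' ?_ k
    rintro _ ⟨_, ⟨u, rfl⟩, rfl⟩
    exact ⟨i u, by simp⟩
  exact h (Submodule.mem_map_of_mem hx)

/-- `∧ᵏU ⊗ ∧ˡV → ∧ᵏ⁺ˡV`, `β ⊗ v ↦ i(β) ∧ v`. -/
def wedgeMul (i : U →ₗ[ℂ] V) (k l : ℕ) : (⋀[ℂ]^k U) ⊗[ℂ] (⋀[ℂ]^l V) →ₗ[ℂ] ⋀[ℂ]^(k + l) V :=
  TensorProduct.lift (LinearMap.mk₂ ℂ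
    (fun β v => ⟨ExteriorAlgebra.map i β.1 * v.1, by
      rw [ExteriorAlgebra.exteriorPower, pow_add]
      exact Submodule.mul_mem_mul (extMap_mem i β.2) v.2⟩)
    (fun _ _ _ => Subtype.ext (by simp [add_mul]))
    (fun _ _ _ => Subtype.ext (by simp))
    (fun _ _ _ => Subtype.ext (by simp [mul_add]))
    (fun _ _ _ => Subtype.ext (by simp)))

@[simp] theorem wedgeMul_tmul (i : U →ₗ[ℂ] V) (k l : ℕ) (β : ⋀[ℂ]^k U) (v : ⋀[ℂ]^l V) :
    (wedgeMul i k l (β ⊗ₜ v) : ExteriorAlgebra ℂ V) = ExteriorAlgebra.map i β.1 * v.1 := rfl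

/-- `∧ᵏU ⊗ ∧¹V → ∧ᵏU ⊗ W`, `β ⊗ v ↦ β ⊗ p(v)`. -/
def symbMap (U : Type u) [AddCommGroup U] [Module ℂ U] (p : V →ₗ[ℂ] W) (k : ℕ) :
    (⋀[ℂ]^k U) ⊗[ℂ] (⋀[ℂ]^1 V) →ₗ[ℂ] (⋀[ℂ]^k U) ⊗[ℂ] W :=
  TensorProduct.map LinearMap.id (p ∘ₗ ExteriorAlgebra.ιInv ∘ₗ (⋀[ℂ]^1 V).subtype)

theorem contractRight_map_eq_zero (i : U →ₗ[ℂ] V) (d : Module.Dual ℂ V) (hd : d ∘ₗ i = 0)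
    (x : ExteriorAlgebra ℂ U) :
    CliffordAlgebra.contractRight (ExteriorAlgebra.map i x) d = 0 := by
  induction x using CliffordAlgebra.right_induction with
  | algebraMap r =>
    rw [AlgHom.commutes]
    exact CliffordAlgebra.contractRight_algebraMap _ d r
  | add x y hx hy => rw [map_add, map_add, LinearMap.add_apply, hx, hy, add_zero]
  | mul_ι m x hx =>
    have h1 : ExteriorAlgebra.map i (CliffordAlgebra.ι 0 m) = CliffordAlgebra.ι 0 (i m) :=
      ExteriorAlgebra.map_apply_ι i m
    rw [map_mul, h1, CliffordAlgebra.contractRight_mul_ι, hx]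
    have : d (i m) = 0 := LinearMap.congr_fun hd m
    simp [this]

/-- The projection to the graded piece is well defined. -/
theorem ker_wedgeMul_le {i : U →ₗ[ℂ] V} {p : V →ₗ[ℂ] W} (hi : Function.Injective i)
    (hpi : p ∘ₗ i = 0) (k : ℕ) :
    LinearMap.ker (wedgeMul i k 1) ≤ LinearMap.ker (symbMap U p k) := by
  classical
  intro z hz
  rw [LinearMap.mem_ker] at hz ⊢
  let 𝒷 := Module.Basis.ofVectorSpace ℂ W
  apply (TensorProduct.equivFinsuppOfBasisRight (M := ⋀[ℂ]^k U) 𝒷).injective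
  rw [map_zero]
  ext κ
  have key : (CliffordAlgebra.contractRight (Q := (0 : QuadraticForm ℂ V))).flip (𝒷.coord κ ∘ₗ p) ∘ₗ
      (⋀[ℂ]^(k + 1) V).subtype ∘ₗ wedgeMul i k 1 =
      (ExteriorAlgebra.map i).toLinearMap ∘ₗ (⋀[ℂ]^k U).subtype ∘ₗ (Finsupp.lapply κ) ∘ₗ
        (TensorProduct.equivFinsuppOfBasisRight (M := ⋀[ℂ]^k U) 𝒷).toLinearMap ∘ₗ
          symbMap U p k := by
    refine TensorProduct.ext' fun β v => ?_
    obtain ⟨v, hv⟩ := v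
    rw [ExteriorAlgebra.exteriorPower, pow_one] at hv
    obtain ⟨v, rfl⟩ := hv
    have h0 := contractRight_map_eq_zero i (𝒷.coord κ ∘ₗ p)
      (by rw [LinearMap.comp_assoc, hpi, LinearMap.comp_zero]) β.1
    have h1 := CliffordAlgebra.contractRight_mul_ι (Q := (0 : QuadraticForm ℂ V))
      (d := 𝒷.coord κ ∘ₗ p) v (ExteriorAlgebra.map i β.1)
    rw [h0, zero_mul, sub_zero] at h1
    have h2 : ExteriorAlgebra.ιInv (R := ℂ) (ExteriorAlgebra.ι ℂ v) = v :=
      ExteriorAlgebra.ι_leftInverse v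
    simp only [LinearMap.comp_apply, symbMap, TensorProduct.map_tmul,
      LinearMap.id_apply, Submodule.subtype_apply, wedgeMul_tmul, LinearMap.flip_apply,
      LinearEquiv.coe_coe, Finsupp.lapply_apply,
      TensorProduct.equivFinsuppOfBasisRight_apply_tmul_apply, h2, AlgHom.toLinearMap_apply]
    refine h1.trans ?_
    simp
  have h := LinearMap.congr_fun key z
  simp only [LinearMap.comp_apply, hz, map_zero] at h
  have hinj : Function.Injective (ExteriorAlgebra.map i) :=
    ExteriorAlgebra.map_injective_field (LinearMap.ker_eq_bot.2 hi)
  have h3 := hinj ((map_zero (ExteriorAlgebra.map i)).trans h)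
  exact congrArg Subtype.val (Submodule.coe_eq_zero.1 h3.symm)

theorem symbMap_congr {i : U →ₗ[ℂ] V} {p : V →ₗ[ℂ] W} (hi : Function.Injective i)
    (hpi : p ∘ₗ i = 0) (k : ℕ) {z z' : (⋀[ℂ]^k U) ⊗[ℂ] (⋀[ℂ]^1 V)}
    (h : wedgeMul i k 1 z = wedgeMul i k 1 z') : symbMap U p k z = symbMap U p k z' := by
  have h0 : wedgeMul i k 1 (z - z') = 0 := by rw [map_sub, h, sub_self]
  have h1 := ker_wedgeMul_le hi hpi k (LinearMap.mem_ker.2 h0)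
  rwa [LinearMap.mem_ker, map_sub, sub_eq_zero] at h1

/-- The projection `F_k → F_k / F_{k+1} ≅ ∧ᵏU ⊗ W`, `i(β) ∧ v ↦ β ⊗ p(v)`, on the image `F_k` of
`∧ᵏU ⊗ V` in `∧ᵏ⁺¹V`. -/
def grMap {i : U →ₗ[ℂ] V} {p : V →ₗ[ℂ] W} (hi : Function.Injective i) (hpi : p ∘ₗ i = 0) (k : ℕ) :
    LinearMap.range (wedgeMul i k 1) →ₗ[ℂ] (⋀[ℂ]^k U) ⊗[ℂ] W where
  toFun w := symbMap U p k w.2.choose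
  map_add' w w' := by
    rw [← map_add]
    refine symbMap_congr hi hpi k ?_
    rw [map_add, w.2.choose_spec, w'.2.choose_spec]
    exact (w + w').2.choose_spec
  map_smul' c w := by
    rw [RingHom.id_apply, ← map_smul]
    refine symbMap_congr hi hpi k ?_
    rw [map_smul, w.2.choose_spec]
    exact (c • w).2.choose_spec

theorem grMap_eq {i : U →ₗ[ℂ] V} {p : V →ₗ[ℂ] W} (hi : Function.Injective i)
    (hpi : p ∘ₗ i = 0) (k : ℕ) (w : LinearMap.range (wedgeMul i k 1))
    (z : (⋀[ℂ]^k U) ⊗[ℂ] (⋀[ℂ]^1 V)) (h : w.1 = wedgeMul i k 1 z) :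
    grMap hi hpi k w = symbMap U p k z :=
  symbMap_congr hi hpi k (w.2.choose_spec.trans h)

/-- `∧ᵏU ⊗ U → ∧ᵏ⁺¹U`, the wedge product. -/
def wedgeProd (U : Type u) [AddCommGroup U] [Module ℂ U] (k : ℕ) :
    (⋀[ℂ]^k U) ⊗[ℂ] U →ₗ[ℂ] ⋀[ℂ]^(k + 1) U :=
  TensorProduct.lift (LinearMap.mk₂ ℂ
    (fun β u => ⟨β.1 * ExteriorAlgebra.ι ℂ u, by
      rw [ExteriorAlgebra.exteriorPower, pow_succ]
      exact Submodule.mul_mem_mul β.2 ⟨u, rfl⟩⟩)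
    (fun _ _ _ => Subtype.ext (by simp [add_mul]))
    (fun _ _ _ => Subtype.ext (by simp))
    (fun _ _ _ => Subtype.ext (by simp [mul_add]))
    (fun _ _ _ => Subtype.ext (by simp)))

/-- `(θ, c) ↦ (T → ∧ᵏU ⊗ W → ∧ᵏU ⊗ U → ∧ᵏ⁺¹U)`. -/
def compWedgeLin (T U W : Type u) [AddCommGroup T] [Module ℂ T] [AddCommGroup U] [Module ℂ U]
    [AddCommGroup W] [Module ℂ W] (k : ℕ) :
    (W →ₗ[ℂ] U) →ₗ[ℂ] (T →ₗ[ℂ] (⋀[ℂ]^k U) ⊗[ℂ] W) →ₗ[ℂ] (T →ₗ[ℂ] ⋀[ℂ]^(k + 1) U) :=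
  LinearMap.mk₂ ℂ (fun θ c => wedgeProd U k ∘ₗ TensorProduct.map LinearMap.id θ ∘ₗ c)
    (fun θ θ' c => by
      rw [TensorProduct.map_add_right, LinearMap.add_comp, LinearMap.comp_add])
    (fun a θ c => by
      rw [TensorProduct.map_smul_right, LinearMap.smul_comp, LinearMap.comp_smul])
    (fun θ c c' => by rw [LinearMap.comp_add, LinearMap.comp_add])
    (fun a θ c => by rw [LinearMap.comp_smul, LinearMap.comp_smul])

end Linear

namespace HolSheaf

variable {E : Type u} [NormedAddCommGroup E] [NormedSpace ℂ E]
  {H : Type u} [TopologicalSpace H] {I : ModelWithCorners ℂ E H}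
  {Y : Type u} [TopologicalSpace Y] [ChartedSpace H Y]

/-- The map `ℋom(T, V) → ℋom(T, W)` induced by `V → W`. -/
def Hom.postcomp {V W : HolSheaf I Y} (φ : Hom V W) (T : HolSheaf I Y) :
    Hom (T.hom V) (T.hom W) where
  app y := LinearMap.compRight ℂ (φ.app y)
  hol hs t ht := φ.hol (hs t ht)

/-- The subsheaf of `∧ᵏ⁺ˡV` which is the image of `∧ᵏU ⊗ ∧ˡV`, for a morphism `U → V`. -/
def filt {U V : HolSheaf I Y} (i : Hom U V) (k l : ℕ) : HolSheaf I Y where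
  fib y := LinearMap.range (wedgeMul (i.app y) k l)
  HolAt s y₀ := ∃ z : ∀ y, (⋀[ℂ]^k (U.fib y)) ⊗[ℂ] (⋀[ℂ]^l (V.fib y)),
    ((U.extPow k).tensor (V.extPow l)).HolAt z y₀ ∧
      ∀ᶠ y in 𝓝 y₀, (s y).1 = wedgeMul (i.app y) k l (z y)
  congr' := by
    rintro s t y₀ ⟨z, hz, hs⟩ h
    exact ⟨z, hz, by filter_upwards [hs, h] with y h1 h2; rw [← h2, h1]⟩
  zero' y₀ := ⟨fun _ => 0, ((U.extPow k).tensor (V.extPow l)).zero' y₀, by simp⟩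
  add' := by
    rintro s t y₀ ⟨z, hz, hs⟩ ⟨z', hz', ht⟩
    refine ⟨fun y => z y + z' y, ((U.extPow k).tensor (V.extPow l)).add' hz hz', ?_⟩
    filter_upwards [hs, ht] with y h1 h2
    rw [map_add, ← h1, ← h2]; rfl
  smul' := by
    rintro f s y₀ hf ⟨z, hz, hs⟩
    refine ⟨fun y => f y • z y, ((U.extPow k).tensor (V.extPow l)).smul' hf hz, ?_⟩
    filter_upwards [hs] with y h1
    rw [map_smul, ← h1]; rfl

/-- The inclusion of the image of `∧ᵏU ⊗ ∧ˡV` in `∧ᵏ⁺ˡV`. -/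
def filtIncl {U V : HolSheaf I Y} (i : Hom U V) (k l : ℕ) : Hom (filt i k l) (V.extPow (k + l)) where
  app y := (LinearMap.range (wedgeMul (i.app y) k l)).subtype
  hol := by
    rintro s y₀ ⟨z, hz, hs⟩
    refine (V.extPow (k + l)).congr' ?_ (by
      filter_upwards [hs] with y h1; exact h1.symm)
    refine GenAt.map (W := V.extPow (k + l)) (fun y => wedgeMul (i.app y) k l) ?_ hz
    rintro _ ⟨β, v, hβ, hv, rfl⟩
    exact V.ext_mul (ext_map i hβ) hv

/-- `algebraMapInv` and `ιInv` preserve holomorphic germs. -/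
theorem ext_parts (V : HolSheaf I Y) {s : ∀ y, ExteriorAlgebra ℂ (V.fib y)} {y₀ : Y}
    (hs : V.ext.HolAt s y₀) :
    HolFunAt I (fun y => ExteriorAlgebra.algebraMapInv (s y)) y₀ ∧
      V.HolAt (fun y => ExteriorAlgebra.ιInv (s y)) y₀ := by
  obtain ⟨w, hw, hs⟩ := hs
  suffices HolFunAt I (fun y => ExteriorAlgebra.algebraMapInv (w y)) y₀ ∧
      V.HolAt (fun y => ExteriorAlgebra.ιInv (w y)) y₀ from
    ⟨this.1.congr_of_eventuallyEq (by filter_upwards [hs] with y h1; rw [h1]),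
      V.congr' this.2 (by filter_upwards [hs] with y h1; rw [h1])⟩
  clear hs
  induction hw using Algebra.adjoin_induction with
  | mem w hw =>
    obtain ⟨f, hf, rfl⟩ | ⟨v, hv, rfl⟩ := hw
    · refine ⟨?_, V.congr' (V.zero' y₀) (Filter.Eventually.of_forall fun y => ?_)⟩
      · simpa [ExteriorAlgebra.algebraMapInv] using hf
      · exact (ιInv_algebraMap _).symm
    · refine ⟨?_, V.congr' hv (Filter.Eventually.of_forall fun y => ?_)⟩
      · have : HolFunAt I (fun _ : Y => (0 : ℂ)) y₀ := contMDiffAt_const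
        simpa [ExteriorAlgebra.algebraMapInv] using this
      · exact (ExteriorAlgebra.ι_leftInverse (v y)).symm
  | algebraMap c =>
    refine ⟨?_, V.congr' (V.zero' y₀) (Filter.Eventually.of_forall fun y => ?_)⟩
    · have : HolFunAt I (fun _ : Y => c) y₀ := contMDiffAt_const
      exact this.congr_of_eventuallyEq (Filter.Eventually.of_forall fun y =>
        ExteriorAlgebra.algebraMapInv.commutes c)
    · exact (ιInv_algebraMap c).symm
  | add v w _ _ h1 h2 =>
    refine ⟨?_, V.congr' (V.add' h1.2 h2.2) (Filter.Eventually.of_forall fun y => ?_)⟩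
    · exact (ContMDiffAt.add h1.1 h2.1).congr_of_eventuallyEq (Filter.Eventually.of_forall fun y =>
        map_add ExteriorAlgebra.algebraMapInv (v y) (w y))
    · exact (map_add ExteriorAlgebra.ιInv (v y) (w y)).symm
  | mul v w _ _ h1 h2 =>
    refine ⟨?_, V.congr' (V.add' (V.smul' h1.1 h2.2) (V.smul' h2.1 h1.2))
      (Filter.Eventually.of_forall fun y => ?_)⟩
    · exact (ContMDiffAt.mul h1.1 h2.1).congr_of_eventuallyEq (Filter.Eventually.of_forall fun y =>
        map_mul ExteriorAlgebra.algebraMapInv (v y) (w y))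
    · exact (ιInv_mul (v y) (w y)).symm

theorem ext_ιInv (V : HolSheaf I Y) {s : ∀ y, ExteriorAlgebra ℂ (V.fib y)} {y₀ : Y}
    (hs : V.ext.HolAt s y₀) : V.HolAt (fun y => ExteriorAlgebra.ιInv (s y)) y₀ :=
  (V.ext_parts hs).2

/-- The projection to the graded piece, on sheaves. -/
def filtGr {U V W : HolSheaf I Y} (i : Hom U V) (p : Hom V W)
    (hi : ∀ y, Function.Injective (i.app y)) (hpi : ∀ y, p.app y ∘ₗ i.app y = 0) (k : ℕ) :
    Hom (filt i k 1) ((U.extPow k).tensor W) where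
  app y := grMap (hi y) (hpi y) k
  hol := by
    rintro s y₀ ⟨z, hz, hs⟩
    refine ((U.extPow k).tensor W).congr' (s := fun y => symbMap (U.fib y) (p.app y) k (z y)) ?_ (by
      filter_upwards [hs] with y h1
      exact (grMap_eq (hi y) (hpi y) k (s y) (z y) h1).symm)
    refine GenAt.map (W := (U.extPow k).tensor W) (fun y => symbMap (U.fib y) (p.app y) k) ?_ hz
    rintro _ ⟨β, v, hβ, hv, rfl⟩
    exact GenAt.of_mem ⟨β, _, hβ, p.hol (V.ext_ιInv hv), rfl⟩

/-- The pairing `ℋom(W, U) × ℋom(T, ∧ᵏU ⊗ W) → ℋom(T, ∧ᵏ⁺¹U)`: compose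
`T → ∧ᵏU ⊗ W → ∧ᵏU ⊗ U → ∧ᵏ⁺¹U`. -/
def compWedge (T U W : HolSheaf I Y) (k : ℕ) :
    Pairing (W.hom U) (T.hom ((U.extPow k).tensor W)) (T.hom (U.extPow (k + 1))) where
  app y := compWedgeLin (T.fib y) (U.fib y) (W.fib y) k
  hol := by
    intro θ c y₀ hθ hc t ht
    refine GenAt.map (W := U.extPow (k + 1))
      (fun y => wedgeProd (U.fib y) k ∘ₗ TensorProduct.map LinearMap.id (θ y)) ?_ (hc t ht)
    rintro _ ⟨β, v, hβ, hv, rfl⟩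
    exact U.ext_mul hβ (U.ext_ι (hθ v hv))

end HolSheaf

/-! ### Supermanifolds -/

section Super

variable {E : Type u} [NormedAddCommGroup E] [NormedSpace ℂ E]
  {H : Type u} [TopologicalSpace H] {I : ModelWithCorners ℂ E H}
  {Y : Type u} [TopologicalSpace Y] [ChartedSpace H Y]

/-- The `j`-th power `⨁_{k ≥ j} ∧ᵏV` of the augmentation ideal of the exterior algebra. -/
def augPow (V : Type u) [AddCommGroup V] [Module ℂ V] (j : ℕ) :
    Submodule ℂ (ExteriorAlgebra ℂ V) :=
  ⨆ k : {k : ℕ // j ≤ k}, ⋀[ℂ]^k.1 V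

namespace HolSheaf

/-- The algebra of holomorphic sections of `∧^• V` over `U`. -/
def alg (V : HolSheaf I Y) (U : Opens Y) :
    Subalgebra ℂ (∀ y : U, ExteriorAlgebra ℂ (V.fib y)) where
  carrier := {s | s ∈ V.ext.sections U}
  add_mem' hs ht := (V.ext.sections U).add_mem hs ht
  mul_mem' {s t} hs ht y := V.ext.congr' (V.ext_mul (hs y) (ht y))
    (Filter.eventually_of_mem (U.isOpen.mem_nhds y.2) fun _ hz =>
      (congrArg₂ (fun a b : ExteriorAlgebra ℂ _ => a * b) (V.ext.extZero_of_mem s hz) (V.ext.extZero_of_mem t hz)).trans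
        (V.ext.extZero_of_mem (s * t) hz).symm)
  algebraMap_mem' c y := V.ext.congr' (V.ext_algebraMap (f := fun _ => c) contMDiffAt_const)
    (Filter.eventually_of_mem (U.isOpen.mem_nhds y.2) fun _ hz =>
      (V.ext.extZero_of_mem (algebraMap ℂ (∀ y : U, ExteriorAlgebra ℂ (V.fib y)) c) hz).symm)

/-- Restriction of sections of `∧^• V`. -/
def resAlg (V : HolSheaf I Y) {U W : Opens Y} (h : U ≤ W) : V.alg W →ₐ[ℂ] V.alg U where
  toFun s := ⟨fun y => s.1 ⟨y, h y.2⟩, V.ext.sections_res h s.2⟩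
  map_one' := rfl
  map_mul' _ _ := rfl
  map_zero' := rfl
  map_add' _ _ := rfl
  commutes' _ := rfl

/-- The grading automorphism of `∧^• V`, equal to `(-1)ᵏ` on `∧ᵏV`. -/
def invol (V : HolSheaf I Y) (U : Opens Y) : V.alg U →ₐ[ℂ] V.alg U where
  toFun s := ⟨fun y => ExteriorAlgebra.map (-LinearMap.id) (s.1 y), fun y =>
    V.ext.congr' (ext_map (V := V) (W := V)
      ⟨fun _ => -LinearMap.id, fun {s y₀} hs => V.congr' (V.const_smul' (-1) hs)
        (Filter.Eventually.of_forall fun y => by simp)⟩ (s.2 y))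
      (Filter.eventually_of_mem (U.isOpen.mem_nhds y.2) fun _ hz =>
        (congrArg (ExteriorAlgebra.map (-LinearMap.id)) (V.ext.extZero_of_mem s.1 hz)).trans
          (V.ext.extZero_of_mem (fun y : U => ExteriorAlgebra.map (-LinearMap.id) (s.1 y))
            hz).symm)⟩
  map_one' := Subtype.ext (funext fun _ => map_one _)
  map_mul' _ _ := Subtype.ext (funext fun _ => map_mul _ _ _)
  map_zero' := Subtype.ext (funext fun _ => map_zero _)
  map_add' _ _ := Subtype.ext (funext fun _ => map_add _ _ _)
  commutes' c := Subtype.ext (funext fun _ => AlgHom.commutes _ c)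

end HolSheaf

/-- The group `𝒢^{(j)}(W)`: the automorphisms `α` of the restriction to `W` of the sheaf of
`ℤ/2`-graded algebras `∧^• V` with `α(u) ≡ u` modulo the `j`-th power of the ideal generated
by `V`, for all local sections `u`. -/
structure SplitAut (V : HolSheaf I Y) (j : ℕ) (W : Opens Y) where
  app : ∀ U : Opens Y, U ≤ W → (V.alg U ≃ₐ[ℂ] V.alg U)
  app_res : ∀ {U U' : Opens Y} (h : U ≤ U') (hW : U' ≤ W) (s : V.alg U'),
    app U (h.trans hW) (V.resAlg h s) = V.resAlg h (app U' hW s)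
  app_invol : ∀ (U : Opens Y) (hU : U ≤ W) (s : V.alg U),
    app U hU (V.invol U s) = V.invol U (app U hU s)
  sub_mem : ∀ (U : Opens Y) (hU : U ≤ W) (s : V.alg U) (y : U),
    (app U hU s).1 y - s.1 y ∈ augPow (V.fib y) j

/-- A supermanifold modelled on `(Y, V)` of splitting type `j`: a `1`-cocycle with values in
`𝒢^{(j)}` on an open cover. -/
structure SuperManifold (V : HolSheaf I Y) (j : ℕ) where
  cover : PCover Y
  ϑ : ∀ x y : Y, SplitAut V j (cover.set x ⊓ cover.set y)
  cocycle : ∀ (x y z : Y) (U : Opens Y) (hx : U ≤ cover.set x) (hy : U ≤ cover.set y)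
    (hz : U ≤ cover.set z) (s : V.alg U),
    (ϑ x z).app U (le_inf hx hz) s = (ϑ y z).app U (le_inf hy hz) ((ϑ x y).app U (le_inf hx hy) s)

namespace SuperManifold

variable {V : HolSheaf I Y} {j : ℕ}

/-- The structure sheaf `𝒪_𝒳` of a supermanifold: a section over `W` is a family of sections
`s_x` of `∧^• V` over `W ∩ U_x` with `s_y = ϑ_{xy}(s_x)` over `W ∩ U_x ∩ U_y`. -/
def 𝒪 (M : SuperManifold V j) (W : Opens Y) :
    Subalgebra ℂ (∀ x : Y, V.alg (W ⊓ M.cover.set x)) where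
  carrier := {s | ∀ (x y : Y) (U : Opens Y) (hx : U ≤ W ⊓ M.cover.set x)
    (hy : U ≤ W ⊓ M.cover.set y),
    (M.ϑ x y).app U (le_inf (hx.trans inf_le_right) (hy.trans inf_le_right)) (V.resAlg hx (s x)) =
      V.resAlg hy (s y)}
  add_mem' {s t} hs ht x y U hx hy := by
    rw [Pi.add_apply, Pi.add_apply, map_add, map_add, map_add, hs x y U hx hy, ht x y U hx hy]
  mul_mem' {s t} hs ht x y U hx hy := by
    rw [Pi.mul_apply, Pi.mul_apply, map_mul, map_mul, map_mul, hs x y U hx hy, ht x y U hx hy]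
  algebraMap_mem' c x y U hx hy := by
    rw [Pi.algebraMap_apply, Pi.algebraMap_apply, AlgHom.commutes, AlgHom.commutes,
      AlgEquiv.commutes]

/-- Restriction of superfunctions. -/
def res (M : SuperManifold V j) {U W : Opens Y} (h : U ≤ W) : M.𝒪 W →ₐ[ℂ] M.𝒪 U where
  toFun s := ⟨fun x => V.resAlg (inf_le_inf_right _ h) (s.1 x), fun x y N hx hy =>
    s.2 x y N (hx.trans (inf_le_inf_right _ h)) (hy.trans (inf_le_inf_right _ h))⟩
  map_one' := rfl
  map_mul' _ _ := rfl
  map_zero' := rfl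
  map_add' _ _ := rfl
  commutes' _ := rfl

/-- The grading automorphism of the structure sheaf. -/
def grading (M : SuperManifold V j) (W : Opens Y) (s : M.𝒪 W) : M.𝒪 W :=
  ⟨fun x => V.invol _ (s.1 x), fun x y U hx hy => by
    change (M.ϑ x y).app U _ (V.invol U (V.resAlg hx (s.1 x))) = V.invol U (V.resAlg hy (s.1 y))
    rw [SplitAut.app_invol, s.2 x y U hx hy]⟩

/-- The value at `y` of a superfunction in the trivialisation over `U_x`. -/
def val (M : SuperManifold V j) {W : Opens Y} (s : M.𝒪 W) (x y : Y) (hW : y ∈ W)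
    (hx : y ∈ M.cover.set x) : ExteriorAlgebra ℂ (V.fib y) :=
  (s.1 x).1 ⟨y, hW, hx⟩

/-- The body of a superfunction: its component in `∧⁰V = 𝒪_Y`. -/
def body (M : SuperManifold V j) {W : Opens Y} (s : M.𝒪 W) (y : Y) (hW : y ∈ W) : ℂ :=
  ExteriorAlgebra.algebraMapInv (M.val s y y hW (M.cover.mem y))

/-- The component in `∧¹V = V` of a superfunction (for `j ≥ 2` it does not depend on the
trivialisation). -/
def lin (M : SuperManifold V j) {W : Opens Y} (s : M.𝒪 W) (y : Y) (hW : y ∈ W) : V.fib y :=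
  ExteriorAlgebra.ιInv (M.val s y y hW (M.cover.mem y))

variable (V j) in
/-- The split model. -/
def split : SuperManifold V j where
  cover := ⟨fun _ => ⊤, fun _ => trivial⟩
  ϑ _ _ :=
    { app := fun _ _ => AlgEquiv.refl
      app_res := fun _ _ _ => rfl
      app_invol := fun _ _ _ => rfl
      sub_mem := fun U _ s y => by
        rw [AlgEquiv.coe_refl, id, sub_self]
        exact Submodule.zero_mem _ }
  cocycle _ _ _ _ _ _ _ _ := rfl

end SuperManifold

/-- The open set `φ⁻¹(W)`. -/
def preim {Y Z : Type u} [TopologicalSpace Y] [TopologicalSpace Z] (φ : C(Y, Z)) (W : Opens Z) :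
    Opens Y := ⟨φ ⁻¹' W, W.isOpen.preimage φ.continuous⟩

variable (I Y) in
/-- A complex manifold regarded as a supermanifold. -/
def reducedSuper : SuperManifold (HolSheaf.zeroSheaf I Y) 2 := SuperManifold.split _ _

/-- Morphisms of supermanifolds with underlying map `φ` of reduced spaces: morphisms of locally
ringed spaces of `ℤ/2`-graded algebras. -/
structure SMor {E' : Type u} [NormedAddCommGroup E'] [NormedSpace ℂ E'] {H' : Type u}
    [TopologicalSpace H'] {I' : ModelWithCorners ℂ E' H'} {Z : Type u} [TopologicalSpace Z]
    [ChartedSpace H' Z] {V : HolSheaf I Y} {V' : HolSheaf I' Z} {j j' : ℕ}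
    (M : SuperManifold V j) (N : SuperManifold V' j') (φ : C(Y, Z)) where
  pull : ∀ W : Opens Z, N.𝒪 W →ₐ[ℂ] M.𝒪 (preim φ W)
  pull_res : ∀ {U W : Opens Z} (h : U ≤ W) (s : N.𝒪 W),
    pull U (N.res h s) = M.res (show preim φ U ≤ preim φ W from fun _ hy => h hy) (pull W s)
  pull_grading : ∀ (W : Opens Z) (s : N.𝒪 W), pull W (N.grading W s) = M.grading _ (pull W s)
  body_pull : ∀ (W : Opens Z) (s : N.𝒪 W) (y : Y) (hy : φ y ∈ W),
    M.body (pull W s) y hy = N.body s (φ y) hy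

section SMor

variable {E' : Type u} [NormedAddCommGroup E'] [NormedSpace ℂ E'] {H' : Type u}
  [TopologicalSpace H'] {I' : ModelWithCorners ℂ E' H'} {Z : Type u} [TopologicalSpace Z]
  [ChartedSpace H' Z] {V : HolSheaf I Y} {V' : HolSheaf I' Z} {j j' : ℕ}
  {M : SuperManifold V j} {N : SuperManifold V' j'} {φ : C(Y, Z)}

/-- The morphism `f` induces the map `q : φ^*V' → V` of odd conormal sheaves. -/
def SMor.Induces (f : SMor M N φ) (q : ∀ y, V'.fib (φ y) →ₗ[ℂ] V.fib y) : Prop :=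
  ∀ (W : Opens Z) (s : N.𝒪 W) (y : Y) (hy : φ y ∈ W),
    M.lin (f.pull W s) y hy = q y (N.lin s (φ y) hy)

/-- The composite of `f : M → N` and `g : N → Z'`, for a complex manifold `Z'`, is the constant
morphism with value the point `b`. -/
def SMor.IsOverPoint {E₂ : Type u} [NormedAddCommGroup E₂] [NormedSpace ℂ E₂] {H₂ : Type u}
    [TopologicalSpace H₂] {I₂ : ModelWithCorners ℂ E₂ H₂} {Z' : Type u} [TopologicalSpace Z']
    [ChartedSpace H₂ Z'] {ψ : C(Z, Z')} (f : SMor M N φ) (g : SMor N (reducedSuper I₂ Z') ψ)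
    (b : Z') : Prop :=
  (∀ y, ψ (φ y) = b) ∧
    ∀ (W : Opens Z') (s : (reducedSuper I₂ Z').𝒪 W) (x y : Y) (hy : ψ (φ y) ∈ W) (hb : b ∈ W)
      (hx : y ∈ M.cover.set x),
      M.val (f.pull (preim ψ W) (g.pull W s)) x y hy hx =
        algebraMap ℂ _ ((reducedSuper I₂ Z').body s b hb)

/-- Commutative squares `g ∘ f = g' ∘ f'` of supermanifolds. -/
def SMor.CommSq {E₂ : Type u} [NormedAddCommGroup E₂] [NormedSpace ℂ E₂] {H₂ : Type u}
    [TopologicalSpace H₂] {I₂ : ModelWithCorners ℂ E₂ H₂} {Z₂ : Type u} [TopologicalSpace Z₂]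
    [ChartedSpace H₂ Z₂] {V₂ : HolSheaf I₂ Z₂} {j₂ : ℕ} {N₂ : SuperManifold V₂ j₂}
    {E₃ : Type u} [NormedAddCommGroup E₃] [NormedSpace ℂ E₃] {H₃ : Type u}
    [TopologicalSpace H₃] {I₃ : ModelWithCorners ℂ E₃ H₃} {Z₃ : Type u} [TopologicalSpace Z₃]
    [ChartedSpace H₃ Z₃] {V₃ : HolSheaf I₃ Z₃} {j₃ : ℕ} {P : SuperManifold V₃ j₃}
    {ψ : C(Z, Z₃)} {φ' : C(Y, Z₂)} {ψ' : C(Z₂, Z₃)}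
    (f : SMor M N φ) (g : SMor N P ψ) (f' : SMor M N₂ φ') (g' : SMor N₂ P ψ') : Prop :=
  (∀ y, ψ (φ y) = ψ' (φ' y)) ∧
    ∀ (W : Opens Z₃) (s : P.𝒪 W) (x y : Y) (hy : ψ (φ y) ∈ W) (hy' : ψ' (φ' y) ∈ W)
      (hx : y ∈ M.cover.set x),
      M.val (f.pull (preim ψ W) (g.pull W s)) x y hy hx =
        M.val (f'.pull (preim ψ' W) (g'.pull W s)) x y hy' hx

end SMor

/-! ### Obstruction classes -/

variable [IsManifold I ω Y]

/-- `T^*_Y` or `V`. -/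
def HolSheaf.cotangentOr (V : HolSheaf I Y) : Bool → HolSheaf I Y
  | true => HolSheaf.cotangent I Y
  | false => V

/-- The sheaf `T^*_{Y,(±)ʲ}` of the model `(Y, V)`: it is `T^*_Y` if `j` is even and `V` if `j` is
odd. -/
def HolSheaf.tpm (V : HolSheaf I Y) (j : ℕ) : HolSheaf I Y := V.cotangentOr (decide (Even j))

/-- The section `a` of `ℋom(T^*_{Y,(±)ʲ}, ∧ʲV)` is the image of `α ∈ 𝒢^{(j)}` in
`𝒢^{(j)} / 𝒢^{(j+1)}`: for `j` even, `α(f) ≡ f + a(df)` for holomorphic functions `f`; for `j` odd,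
`α(θ) ≡ θ + a(θ)` for sections `θ` of `V`, modulo the `(j+1)`-st power of the augmentation
ideal. -/
def SplitAut.IsSymbol {V : HolSheaf I Y} {j : ℕ} {W N : Opens Y} (α : SplitAut V j W) :
    (e : Bool) → ((V.cotangentOr e).hom (V.extPow j)).sections N → Prop
  | true, a => ∀ (U : Opens Y) (hU : U ≤ W) (hN : U ≤ N) (u : V.alg U) (f : Y → ℂ),
      (∀ y : U, HolFunAt I f y.1) → (∀ y : U, u.1 y = algebraMap ℂ _ (f y)) → ∀ y : U,
      (α.app U hU u).1 y - u.1 y -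
        ((show (TangentSpace I y.1 →ₗ[ℂ] ℂ) →ₗ[ℂ] ⋀[ℂ]^j (V.fib y) from a.1 ⟨y, hN y.2⟩)
          (mfderiv I 𝓘(ℂ, ℂ) f y.1 : TangentSpace I y.1 →L[ℂ] ℂ).toLinearMap).1 ∈
        augPow (V.fib y) (j + 1)
  | false, a => ∀ (U : Opens Y) (hU : U ≤ W) (hN : U ≤ N) (u : V.alg U) (θ : V.sections U),
      (∀ y : U, u.1 y = ExteriorAlgebra.ι ℂ (θ.1 y)) → ∀ y : U,
      (α.app U hU u).1 y - u.1 y -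
        ((show V.fib y →ₗ[ℂ] ⋀[ℂ]^j (V.fib y) from a.1 ⟨y, hN y.2⟩) (θ.1 y)).1 ∈
        augPow (V.fib y) (j + 1)

/-- The obstruction sheaf `𝒜^{(j)} = ℋom(T^*_{Y,(±)ʲ}, ∧ʲV)`. -/
abbrev HolSheaf.obsSheaf (V : HolSheaf I Y) (j : ℕ) : HolSheaf I Y := (V.tpm j).hom (V.extPow j)

/-- `ω ∈ H¹(Y, 𝒜^{(j)})` is the obstruction to splitting `M`: the image of the class of `M` under
`Ȟ¹(Y, 𝒢^{(j)}) → H¹(Y, 𝒢^{(j)} / 𝒢^{(j+1)}) = H¹(Y, 𝒜^{(j)})`. -/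
def SuperManifold.IsObstruction {V : HolSheaf I Y} {j : ℕ} (M : SuperManifold V j)
    (o : (V.obsSheaf j).Coh 1) : Prop :=
  ∃ c : (V.obsSheaf j).Cocycle M.cover 1,
    (∀ i : Fin 2 → Y, (M.ϑ (i 0) (i 1)).IsSymbol (decide (Even j)) (c.1 i)) ∧
      (V.obsSheaf j).cls c = o

end Super

/-! ### gt-models and gtm-families -/

section GT

variable {EX : Type u} [NormedAddCommGroup EX] [NormedSpace ℂ EX]
  {HX : Type u} [TopologicalSpace HX] {IX : ModelWithCorners ℂ EX HX}
  {X : Type u} [TopologicalSpace X] [ChartedSpace HX X]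
  {EB : Type u} [NormedAddCommGroup EB] [NormedSpace ℂ EB]
  {HB : Type u} [TopologicalSpace HB] {IB : ModelWithCorners ℂ EB HB}
  {B : Type u} [TopologicalSpace B] [ChartedSpace HB B]

/-- A `gt`-model over `(B, T_B)` with fibre `(X, T_X)` and `Y = X × B`: a short exact sequence of
sheaves `0 → p_B^* T_B → T_Y → p_X^* T_X → 0`. For locally free sheaves it is exact both on germs
of holomorphic sections and on fibres. -/
structure GTModel (TX : HolSheaf IX X) (TB : HolSheaf IB B)
    (TY : HolSheaf (IX.prod IB) (X × B)) where
  incl : HolSheaf.Hom (TB.pullback (IX.prod IB) Prod.snd) TY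
  proj : HolSheaf.Hom TY (TX.pullback (IX.prod IB) Prod.fst)
  incl_injective : ∀ y, Function.Injective (incl.app y)
  proj_surjective : ∀ y, Function.Surjective (proj.app y)
  exact : ∀ y, Function.Exact (incl.app y) (proj.app y)
  exact_germ : ∀ (t : ∀ y, TY.fib y) (y₀ : X × B), TY.HolAt t y₀ →
    (∀ᶠ y in 𝓝 y₀, proj.app y (t y) = 0) →
    ∃ v : ∀ y, (TB.pullback (IX.prod IB) Prod.snd).fib y,
      (TB.pullback (IX.prod IB) Prod.snd).HolAt v y₀ ∧ ∀ᶠ y in 𝓝 y₀, incl.app y (v y) = t y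
  proj_surjective_germ : ∀ (w : ∀ y, (TX.pullback (IX.prod IB) Prod.fst).fib y) (y₀ : X × B),
    (TX.pullback (IX.prod IB) Prod.fst).HolAt w y₀ →
    ∃ t : ∀ y, TY.fib y, TY.HolAt t y₀ ∧ ∀ᶠ y in 𝓝 y₀, proj.app y (t y) = w y

/-- The inclusion `x ↦ (x, b)` of a fibre of `X × B → B`. -/
def fibreIncl (X : Type u) [TopologicalSpace X] {B : Type u} [TopologicalSpace B] (b : B) :
    C(X, X × B) := ⟨fun x => (x, b), by fun_prop⟩

/-- The projection `X × B → B`. -/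
def baseProj (X B : Type u) [TopologicalSpace X] [TopologicalSpace B] : C(X × B, B) :=
  ⟨Prod.snd, continuous_snd⟩

/-- A `gtm`-family of supermanifolds modelled on `(X, T_X)` over the reduced space `B`: a
supermanifold modelled on `(X × B, p_X^* T_X)` with a morphism to `B` lifting the projection
`X × B → B`, such that for each `b` a supermanifold modelled on `(X, T_X)` embeds into it over
the point `b`. The embedding lifts `x ↦ (x, b)` and induces on odd conormal sheaves the
canonical surjection `(p_X^* T_X)|_{X × {b}} → T_X`. -/
structure ReducedGtmFamily (TX : HolSheaf IX X) (IB : ModelWithCorners ℂ EB HB) (B : Type u)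
    [TopologicalSpace B] [ChartedSpace HB B] where
  compact : CompactSpace X
  total : SuperManifold (TX.pullback (IX.prod IB) (Prod.fst : X × B → X)) 2
  toBase : SMor total (reducedSuper IB B) (baseProj X B)
  fibre : B → SuperManifold TX 2
  fibreEmb : ∀ b : B, SMor (fibre b) total (fibreIncl X b)
  fibreEmb_induces : ∀ b : B, (fibreEmb b).Induces fun _ => LinearMap.id
  fibreEmb_over : ∀ b : B, (fibreEmb b).IsOverPoint toBase b

namespace GTModel

open HolSheaf

variable {TX : HolSheaf IX X} {TB : HolSheaf IB B} {TY : HolSheaf (IX.prod IB) (X × B)}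

/-- A `gtm`-family of supermanifolds of splitting type `j` with total space model `S`: a morphism
from a supermanifold modelled on `(Y, T_Y)`, `Y = X × B`, to a supermanifold modelled
on `(B, T_B)` which contains a `gtm`-family over the reduced space `B` lying over the natural
embedding of `B`. -/
structure GtmFamily (S : GTModel TX TB TY) (j : ℕ) where
  base : SuperManifold TB 2
  total : SuperManifold TY j
  toBase : SMor total base (baseProj X B)
  underlying : ReducedGtmFamily TX IB B
  emb : SMor underlying.total total (ContinuousMap.id _)
  emb_induces : emb.Induces S.proj.app
  baseEmb : SMor (reducedSuper IB B) base (ContinuousMap.id _)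
  comm : emb.CommSq toBase underlying.toBase baseEmb

/-- `Θ ∈ H¹(Y, ℋom(p_X^* T_X, p_B^* T_B)) = Ext¹(p_X^* T_X, p_B^* T_B)` is the class of the
extension `T_Y`: the image of the identity of `p_X^* T_X` under the connecting map. It is
represented by the differences of local splittings `σ`. -/
def IsModelClass (S : GTModel TX TB TY)
    (Θ : ((TX.pullback (IX.prod IB) Prod.fst).hom
      (TB.pullback (IX.prod IB) Prod.snd)).Coh 1) : Prop :=
  ∃ (U : PCover (X × B)) (σ : ((TX.pullback (IX.prod IB) Prod.fst).hom TY).Cochain U 0)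
    (c : ((TX.pullback (IX.prod IB) Prod.fst).hom
      (TB.pullback (IX.prod IB) Prod.snd)).Cocycle U 1),
    (∀ (i : Fin 1 → X × B) (y : U.inter i), S.proj.app y ∘ₗ (σ i).1 y = LinearMap.id) ∧
    (S.incl.postcomp (TX.pullback (IX.prod IB) Prod.fst)).cochain U 1 c.1 =
      ((TX.pullback (IX.prod IB) Prod.fst).hom TY).δ U 0 σ ∧
    HolSheaf.cls _ c = Θ

variable [IsManifold (IX.prod IB) ω (X × B)]

/-- The sheaf `ℋom(T^*_{Y,(±)^{b+1}}, ∧ᵇT_B ⊠ T_X)`. -/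
abbrev gradedSheaf (_ : GTModel TX TB TY) (b : ℕ) : HolSheaf (IX.prod IB) (X × B) :=
  (TY.tpm (b + 1)).hom
    (((TB.pullback (IX.prod IB) Prod.snd).extPow b).tensor (TX.pullback (IX.prod IB) Prod.fst))

/-- The space `𝐇^{1,b}_n(Y, T_Y) = Hⁿ(Y, ℋom(T^*_{Y,(±)^{b+1}}, ∧ᵇT_B ⊠ T_X))`. -/
abbrev H1 (S : GTModel TX TB TY) (b n : ℕ) : Type u := (S.gradedSheaf b).Coh n

/-- The space `𝐇^{0,b+1}_n(Y, T_Y) = Hⁿ(Y, ℋom(T^*_{Y,(±)^{b+1}}, ∧ᵇ⁺¹T_B))`. -/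
abbrev H0 (_ : GTModel TX TB TY) (b n : ℕ) : Type u :=
  ((TY.tpm (b + 1)).hom ((TB.pullback (IX.prod IB) Prod.snd).extPow (b + 1))).Coh n

/-- The map `(Θ, -)_*^{1,b} : 𝐇^{1,b}_1 → 𝐇^{0,b+1}_2`: the cup product with `Θ`, along
`ℋom(T_X, T_B) ⊗ ℋom(T, ∧ᵇT_B ⊠ T_X) → ℋom(T, ∧ᵇT_B ⊠ T_B) → ℋom(T, ∧ᵇ⁺¹T_B)`. -/
def modelClassMap (S : GTModel TX TB TY)
    (Θ : ((TX.pullback (IX.prod IB) Prod.fst).hom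
      (TB.pullback (IX.prod IB) Prod.snd)).Coh 1) (b : ℕ) : S.H1 b 1 →ₗ[ℂ] S.H0 b 2 :=
  (compWedge (TY.tpm (b + 1)) (TB.pullback (IX.prod IB) Prod.snd)
    (TX.pullback (IX.prod IB) Prod.fst) b).cup Θ

/-- The map `ι_{b*} : H¹(Y, ℋom(T^*_{Y,(±)^{b+1}}, F_b)) → H¹(Y, 𝒜^{(b+1)})`, where `F_b` is the
image of `∧ᵇT_B ⊗ T_Y` in `∧ᵇ⁺¹T_Y`. -/
def filtMap (S : GTModel TX TB TY) (b : ℕ) :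
    ((TY.tpm (b + 1)).hom (filt S.incl b 1)).Coh 1 →ₗ[ℂ] (TY.obsSheaf (b + 1)).Coh 1 :=
  ((filtIncl S.incl b 1).postcomp (TY.tpm (b + 1))).coh 1

/-- The map `ι_{b+1*} : H¹(Y, ℋom(T^*_{Y,(±)^{b+1}}, F_{b+1})) → H¹(Y, 𝒜^{(b+1)})`, where `F_{b+1}`
is the image of `∧ᵇ⁺¹T_B` in `∧ᵇ⁺¹T_Y`. -/
def filtMapTop (S : GTModel TX TB TY) (b : ℕ) :
    ((TY.tpm (b + 1)).hom (filt S.incl (b + 1) 0)).Coh 1 →ₗ[ℂ] (TY.obsSheaf (b + 1)).Coh 1 :=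
  ((filtIncl S.incl (b + 1) 0).postcomp (TY.tpm (b + 1))).coh 1

/-- The map `H¹(Y, ℋom(T^*_{Y,(±)^{b+1}}, F_b)) → 𝐇^{1,b}_1` induced by
`F_b → F_b / F_{b+1} ≅ ∧ᵇT_B ⊠ T_X`. -/
def grMapCoh (S : GTModel TX TB TY) (b : ℕ) :
    ((TY.tpm (b + 1)).hom (filt S.incl b 1)).Coh 1 →ₗ[ℂ] S.H1 b 1 :=
  ((filtGr S.incl S.proj S.incl_injective
    (fun y => (S.exact y).linearMap_comp_eq_zero) b).postcomp (TY.tpm (b + 1))).coh 1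

/-- `ν ∈ 𝐇^{1,b}_1` is the secondary obstruction to splitting the family `𝓕`, of refined splitting
type `1 + b`: the obstruction `o` to splitting its total space lies in the image of `ι_{b*}` and not
in that of `ι_{b+1*}`, and `ν` is the projection of a preimage of `o` under `ι_{b*}`. -/
def GtmFamily.IsSecondaryObstruction {S : GTModel TX TB TY} {b : ℕ} (𝓕 : S.GtmFamily (b + 1))
    (ν : S.H1 b 1) : Prop :=
  ∃ o : (TY.obsSheaf (b + 1)).Coh 1, 𝓕.total.IsObstruction o ∧
    o ∉ LinearMap.range (S.filtMapTop b) ∧ ∃ w, S.filtMap b w = o ∧ S.grMapCoh b w = ν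

end GTModel

end GT

end

/-! ### Linear algebra: retractions of an injection and the maps they induce on exterior powers. -/

section Retraction

variable {U V W : Type u} [AddCommGroup U] [Module ℂ U] [AddCommGroup V] [Module ℂ V]
  [AddCommGroup W] [Module ℂ W]

/-! The class `ν` itself serves as `ν'`. It is non-zero because the linear model class map does not
kill it. A secondary obstruction is by definition the image of some `w ∈ H¹(Y, ℋom(T, F_b))` under
the projection `F_b → F_b / F_{b+1}`, where `T` stands for the sheaf `T_{(±)^{b+1}}` and `j' = b +
1`. So it is enough that the model class map vanishes on every such image.

This vanishing is part of a long exact sequence. Up to sign, cup product with `Θ` is the connecting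
map of `0 → F_{b+1} → F_b → ∧ᵇT_B ⊗ T_X → 0` after applying `ℋom(T, -)`, with `F_{b+1}` identified
with `∧ᵇ⁺¹T_B`. A class that lifts to the middle term is killed by the connecting map. The reason is
that the extension class of `F_b` is induced by that of `T_Y`: a local retraction `r` of `T_B → T_Y`
gives a local retraction `∧ᵇ⁺¹r` of `∧ᵇ⁺¹T_B → F_b`, and if two retractions of `T_Y` differ by `θ ∘
p`, where `p` is the projection to `T_X`, the induced ones differ on `F_b` by the projection to
`∧ᵇT_B ⊗ T_X`, followed by `θ` on the second factor and the wedge product. Higher order terms in `θ`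
do not occur, since `F_b` is spanned by products `i(β) ∧ v` with a single factor `v` outside `T_B`.

The proof makes this explicit on cochains, without constructing a connecting map. From local
splittings representing `Θ` come local retractions `r_x` with `r_x - r_{x'} = θ_{xx'} ∘ p`
(`exists_local_retractions`). If the cocycle `c` represents `w`, the cochain `e_{xx'} = ∧ᵇ⁺¹(r_x) ∘
c_{xx'}` satisfies `δe = -(θ ∪ gr c)`. The fibrewise identity behind this is
`extPowMap_sub_extPowMap`, and the cochain computation is `cup_filtGr_cls_eq_zero`. That `e` is
holomorphic follows from exactness of the sequence on germs (`holAt_retraction`, `holAt_extPowMap`).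
-/

/-- A splitting `s` of a short exact sequence `0 → U → V → W → 0` yields a retraction `V → U`. -/
theorem exists_retraction {i : U →ₗ[ℂ] V} {p : V →ₗ[ℂ] W} (hi : Function.Injective i)
    (hex : Function.Exact i p) {s : W →ₗ[ℂ] V} (hs : p ∘ₗ s = LinearMap.id) :
    ∃ r : V →ₗ[ℂ] U, ∀ v, i (r v) = v - s (p v) := by
  -- Since `p ∘ s = id`, the map `id - s ∘ p` lands in `ker p = range i`, where the injection `i`
  -- can be inverted.
  have hmem : ∀ v, (LinearMap.id - s ∘ₗ p : V →ₗ[ℂ] V) v ∈ LinearMap.range i := fun v => by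
    refine (hex _).1 ?_
    have h := LinearMap.congr_fun hs (p v)
    simp only [LinearMap.comp_apply, LinearMap.id_apply] at h
    simp [h]
  refine ⟨(LinearEquiv.ofInjective i hi).symm.toLinearMap ∘ₗ
    (LinearMap.id - s ∘ₗ p).codRestrict (LinearMap.range i) hmem, fun v => ?_⟩
  simp

/-- The map `∧ⁿV → ∧ⁿU` induced by `r : V → U`. -/
def extPowMap (r : V →ₗ[ℂ] U) (n : ℕ) : ⋀[ℂ]^n V →ₗ[ℂ] ⋀[ℂ]^n U :=
  ((ExteriorAlgebra.map r).toLinearMap ∘ₗ (⋀[ℂ]^n V).subtype).codRestrict _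
    fun v => extMap_mem r v.2

/-- A retraction `r` of `i` maps `i(β) ∧ v` to `β ∧ r(v)`. -/
theorem extPowMap_wedgeMul {i : U →ₗ[ℂ] V} {r : V →ₗ[ℂ] U} (hr : r ∘ₗ i = LinearMap.id) (k : ℕ)
    (z : (⋀[ℂ]^k U) ⊗[ℂ] (⋀[ℂ]^1 V)) :
    extPowMap r (k + 1) (wedgeMul i k 1 z) = wedgeProd U k (symbMap U r k z) := by
  -- Here `symbMap` is used with the retraction `r` in the role of the quotient map. It does not
  -- satisfy `r ∘ i = 0`, so `symbMap U r k z` by itself is not determined by the product `wedgeMul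
  -- i k 1 z`; after wedging, it is.
  suffices extPowMap r (k + 1) ∘ₗ wedgeMul i k 1 = wedgeProd U k ∘ₗ symbMap U r k from
    LinearMap.congr_fun this z
  refine TensorProduct.ext' fun β v => Subtype.ext ?_
  obtain ⟨v, hv⟩ := v
  rw [ExteriorAlgebra.exteriorPower, pow_one] at hv
  obtain ⟨v, rfl⟩ := hv
  -- By functoriality `∧r ∘ ∧i = ∧(r ∘ i) = id`, so the algebra map `∧r` leaves the factor `β` alone
  -- and acts only on `v`.
  have h : ExteriorAlgebra.map r (ExteriorAlgebra.map i β.1) = β.1 := by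
    rw [← AlgHom.comp_apply, ExteriorAlgebra.map_comp_map, hr, ExteriorAlgebra.map_id,
      AlgHom.id_apply]
  have h2 : ExteriorAlgebra.ιInv (R := ℂ) (ExteriorAlgebra.ι ℂ v) = v :=
    ExteriorAlgebra.ι_leftInverse v
  change ExteriorAlgebra.map r (ExteriorAlgebra.map i β.1 * ExteriorAlgebra.ι ℂ v) =
    β.1 * ExteriorAlgebra.ι ℂ (r (ExteriorAlgebra.ιInv (ExteriorAlgebra.ι ℂ v)))
  rw [map_mul, h, h2, ExteriorAlgebra.map_apply_ι]

/-- Retractions `r, r'` of `i` with `r - r' = -θ ∘ p` induce maps on `F_k ⊆ ∧ᵏ⁺¹V` whose difference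
factors through `F_k / F_{k+1} ≅ ∧ᵏU ⊗ W`. -/
theorem extPowMap_sub_extPowMap {i : U →ₗ[ℂ] V} {p : V →ₗ[ℂ] W} (hi : Function.Injective i)
    (hpi : p ∘ₗ i = 0) {r r' : V →ₗ[ℂ] U} (hr : r ∘ₗ i = LinearMap.id)
    (hr' : r' ∘ₗ i = LinearMap.id) {θ : W →ₗ[ℂ] U} (hθ : ∀ v, r' v - r v = θ (p v)) (k : ℕ)
    (x : LinearMap.range (wedgeMul i k 1)) :
    extPowMap r' (k + 1) x.1 - extPowMap r (k + 1) x.1 =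
      wedgeProd U k (TensorProduct.map LinearMap.id θ (grMap hi hpi k x)) := by
  -- Once a preimage `z` in `∧ᵏU ⊗ ∧¹V` is chosen, all three terms are computed on `z`; `grMap_eq`
  -- makes the right side independent of the choice.
  obtain ⟨_, z, rfl⟩ := x
  rw [grMap_eq hi hpi k _ z rfl]
  change extPowMap r' (k + 1) (wedgeMul i k 1 z) - extPowMap r (k + 1) (wedgeMul i k 1 z) = _
  -- The relation `r' = r + θ ∘ p` is applied to the one tensor factor on which the retraction acts,
  -- so the correction is linear in `θ`.
  have key : symbMap U r' k = symbMap U r k + TensorProduct.map LinearMap.id θ ∘ₗ symbMap U p k := by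
    refine TensorProduct.ext' fun β v => ?_
    simp only [symbMap, LinearMap.add_apply, LinearMap.comp_apply, TensorProduct.map_tmul,
      LinearMap.id_apply]
    rw [← TensorProduct.tmul_add, ← hθ, add_sub_cancel]
  rw [extPowMap_wedgeMul hr, extPowMap_wedgeMul hr', key, LinearMap.add_apply, map_add,
    add_sub_cancel_left, LinearMap.comp_apply]

end Retraction

/-! ### Holomorphy of retractions and of the maps they induce on `F_k`. -/

namespace HolSheaf

variable {E : Type u} [NormedAddCommGroup E] [NormedSpace ℂ E]
  {H : Type u} [TopologicalSpace H] {I : ModelWithCorners ℂ E H}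
  {Y : Type u} [TopologicalSpace Y] [ChartedSpace H Y]

theorem holAt_ev (V : HolSheaf I Y) {C : PCover Y} {n : ℕ} (c : V.Cochain C n)
    (x : Fin (n + 1) → Y) {y : Y} (hy : y ∈ C.inter x) : V.HolAt (V.ev c x) y :=
  (c x).2 ⟨y, hy⟩

theorem ev_cochain {V W : HolSheaf I Y} (φ : Hom V W) {C : PCover Y} {n : ℕ} (c : V.Cochain C n)
    (x : Fin (n + 1) → Y) {y : Y} (hy : y ∈ C.inter x) :
    W.ev (φ.cochain C n c) x y = φ.app y (V.ev c x y) := by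
  rw [ev_mem _ _ _ hy, ev_mem _ _ _ hy]
  rfl

variable {U V W : HolSheaf I Y}

/-- The retraction attached to a holomorphic splitting of an exact sequence is holomorphic. -/
theorem holAt_retraction (i : Hom U V) (p : Hom V W) (hi : ∀ y, Function.Injective (i.app y))
    {y₀ : Y}
    (hgerm : ∀ t : ∀ y, V.fib y, V.HolAt t y₀ → (∀ᶠ y in 𝓝 y₀, p.app y (t y) = 0) →
      ∃ v : ∀ y, U.fib y, U.HolAt v y₀ ∧ ∀ᶠ y in 𝓝 y₀, i.app y (v y) = t y)
    {s : ∀ y, W.fib y →ₗ[ℂ] V.fib y} (hs : (W.hom V).HolAt s y₀)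
    (hps : ∀ᶠ y in 𝓝 y₀, p.app y ∘ₗ s y = LinearMap.id)
    {r : ∀ y, V.fib y →ₗ[ℂ] U.fib y}
    (hr : ∀ᶠ y in 𝓝 y₀, ∀ v, i.app y (r y v) = v - s y (p.app y v)) :
    (V.hom U).HolAt r y₀ := by
  intro t ht
  -- The germ `t - s(p(t))` is holomorphic and killed by `p`, so exactness on germs lifts it to a
  -- holomorphic germ `v`. Fibrewise injectivity of `i` then forces `v = r(t)`; injectivity on
  -- fibres without germ exactness would not give holomorphy.
  obtain ⟨v, hv, hiv⟩ := hgerm (fun y => t y - s y (p.app y (t y)))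
    (V.sub' ht (hs _ (p.hol ht))) (by
      filter_upwards [hps] with y hy
      have h := LinearMap.congr_fun hy (p.app y (t y))
      simp only [LinearMap.comp_apply, LinearMap.id_apply] at h
      rw [map_sub, h, sub_self])
  refine U.congr' hv ?_
  filter_upwards [hiv, hr] with y h1 h2
  exact hi y (h1.trans (h2 (t y)).symm)

/-- A holomorphic retraction of `i : U → V` induces a holomorphic map `F_k → ∧ᵏ⁺¹U`. -/
theorem holAt_extPowMap (i : Hom U V) (k : ℕ) {y₀ : Y} {r : ∀ y, V.fib y →ₗ[ℂ] U.fib y}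
    (hr : (V.hom U).HolAt r y₀) (hri : ∀ᶠ y in 𝓝 y₀, r y ∘ₗ i.app y = LinearMap.id)
    {s : ∀ y, (filt i k 1).fib y} (hs : (filt i k 1).HolAt s y₀) :
    (U.extPow (k + 1)).HolAt (fun y => extPowMap (r y) (k + 1) (s y).1) y₀ := by
  obtain ⟨z, hz, hs⟩ := hs
  -- A germ of `F_k` is the image of a holomorphic germ `z` of the tensor product, and
  -- `extPowMap_wedgeMul` rewrites the induced map in terms of `z`. Holomorphy then has to be
  -- checked on generators only, where the value is `β ∧ r(v)`.
  refine (U.extPow (k + 1)).congr'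
    (s := fun y => (wedgeProd (U.fib y) k ∘ₗ symbMap (U.fib y) (r y) k) (z y)) ?_ ?_
  · refine GenAt.map (W := U.extPow (k + 1))
      (fun y => wedgeProd (U.fib y) k ∘ₗ symbMap (U.fib y) (r y) k) ?_ hz
    rintro _ ⟨β, v, hβ, hv, rfl⟩
    exact U.ext_mul hβ (U.ext_ι (hr _ (V.ext_ιInv hv)))
  · filter_upwards [hs, hri] with y h1 h2
    rw [h1, extPowMap_wedgeMul h2]
    rfl

/-- A cochain with prescribed holomorphic values. -/
theorem exists_cochain (V : HolSheaf I Y) {C : PCover Y} {n : ℕ}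
    (s : (Fin (n + 1) → Y) → ∀ y, V.fib y) (hs : ∀ x, ∀ y ∈ C.inter x, V.HolAt (s x) y) :
    ∃ e : V.Cochain C n, ∀ x, ∀ y ∈ C.inter x, V.ev e x y = s x y :=
  ⟨fun x => ⟨fun y => s x y, fun y => V.congr' (hs x y y.2)
    (Filter.eventually_of_mem ((C.inter x).isOpen.mem_nhds y.2) fun _ hz =>
      (V.extZero_of_mem (fun y : C.inter x => s x y) hz).symm)⟩, fun _ _ hy => V.ev_mem _ _ hy⟩

/-- The value, extended by zero, of a cochain with values in `ℋom(V, W)`. -/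
noncomputable def evHom (V W : HolSheaf I Y) {C : PCover Y} {n : ℕ} (c : (V.hom W).Cochain C n)
    (x : Fin (n + 1) → Y) (y : Y) : V.fib y →ₗ[ℂ] W.fib y := (V.hom W).ev c x y

theorem mem_inter₁ {C : PCover Y} {x y : Y} (h : y ∈ C.set x) : y ∈ C.inter ![x] :=
  PCover.mem_inter.2 fun m => by fin_cases m; exact h

theorem mem_inter₂ {C : PCover Y} {x x' y : Y} (h : y ∈ C.set x) (h' : y ∈ C.set x') :
    y ∈ C.inter ![x, x'] :=
  PCover.mem_inter.2 fun m => by fin_cases m <;> assumption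

/-! ### Čech cochains: local retractions and the vanishing of the cup product. -/

/-- The local retractions attached to local splittings `σ` of an exact sequence; they differ by
the extension cocycle `θ`. -/
theorem exists_local_retractions (i : Hom U V) (p : Hom V W)
    (hi : ∀ y, Function.Injective (i.app y))
    (hex : ∀ y, Function.Exact (i.app y) (p.app y))
    (hgerm : ∀ (t : ∀ y, V.fib y) (y₀ : Y), V.HolAt t y₀ → (∀ᶠ y in 𝓝 y₀, p.app y (t y) = 0) →
      ∃ v : ∀ y, U.fib y, U.HolAt v y₀ ∧ ∀ᶠ y in 𝓝 y₀, i.app y (v y) = t y)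
    {C : PCover Y} (σ : (W.hom V).Cochain C 0) (θ : (W.hom U).Cochain C 1)
    (hσ : ∀ (x : Fin 1 → Y) (y : C.inter x), p.app y ∘ₗ (σ x).1 y = LinearMap.id)
    (hθ : (i.postcomp W).cochain C 1 θ = (W.hom V).δ C 0 σ) :
    ∃ r : Y → ∀ y, V.fib y →ₗ[ℂ] U.fib y,
      (∀ x, ∀ y ∈ C.set x, r x y ∘ₗ i.app y = LinearMap.id) ∧
      (∀ x, ∀ y ∈ C.set x, (V.hom U).HolAt (r x) y) ∧
      ∀ x x' y, y ∈ C.set x → y ∈ C.set x' → ∀ v,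
        r x y v - r x' y v = evHom W U θ ![x, x'] y (p.app y v) := by
  have hs : ∀ {x y : Y}, y ∈ C.set x → p.app y ∘ₗ evHom W V σ ![x] y = LinearMap.id :=
    fun {x y} hy => by
      rw [evHom, ev_mem _ _ _ (mem_inter₁ hy)]
      exact hσ ![x] ⟨y, mem_inter₁ hy⟩
  -- The retraction is needed at every point so that it can be chosen as a function on all of `Y`.
  -- Away from `C.set x` nothing is required of it and the value `0` is taken.
  have hex' : ∀ x y : Y, ∃ r : V.fib y →ₗ[ℂ] U.fib y, y ∈ C.set x → ∀ v, i.app y (r v) =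
      v - evHom W V σ ![x] y (p.app y v) := fun x y => by
    by_cases hy : y ∈ C.set x
    · obtain ⟨r, hr⟩ := exists_retraction (hi y) (hex y) (hs hy)
      exact ⟨r, fun _ => hr⟩
    · exact ⟨0, fun h => absurd h hy⟩
  choose r hr using hex'
  refine ⟨r, fun x y hy => ?_, fun x y hy => ?_, fun x x' y hx hx' v => ?_⟩
  -- On `i(u)` the correction term `σ_x(p(i(u)))` is zero by exactness, so `i(r_x(i(u))) = i(u)`.
  · ext u
    apply hi y
    rw [LinearMap.comp_apply, hr x y hy, (hex y).apply_apply_eq_zero, map_zero, sub_zero,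
      LinearMap.id_apply]
  · exact holAt_retraction i p hi (fun t => hgerm t y) (holAt_ev _ σ ![x] (mem_inter₁ hy))
      (Filter.eventually_of_mem ((C.set x).isOpen.mem_nhds hy) fun _ hz => hs hz)
      (Filter.eventually_of_mem ((C.set x).isOpen.mem_nhds hy) fun z hz => hr x z hz)
  -- After applying `i`, the left side is `(v - σ_x(p v)) - (v - σ_{x'}(p v)) = (σ_{x'} - σ_x)(p
  -- v)`. This is `(δσ)_{xx'}` at `p v`, hence `i(θ_{xx'}(p v))`; the sign convention of `δ` fixes
  -- the order of `x` and `x'`.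
  · apply hi y
    have h := ev_cochain (i.postcomp W) θ _ (mem_inter₂ hx hx')
    rw [hθ, ev_δ₀ _ _ _ (mem_inter₂ hx hx')] at h
    refine Eq.trans ?_ (LinearMap.congr_fun h (p.app y v))
    rw [map_sub, hr x y hx, hr x' y hx']
    exact sub_sub_sub_cancel_left _ _ _

/-- For an extension `0 → U → V → W → 0` with class `θ`, the composite of
`H¹(ℋom(T, F_k)) → H¹(ℋom(T, ∧ᵏU ⊗ W))` with the cup product with `θ` vanishes: up to sign, the
latter is the connecting map of `0 → F_{k+1} → F_k → ∧ᵏU ⊗ W → 0`. -/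
theorem cup_filtGr_cls_eq_zero (i : Hom U V) (p : Hom V W)
    (hi : ∀ y, Function.Injective (i.app y))
    (hex : ∀ y, Function.Exact (i.app y) (p.app y))
    (hgerm : ∀ (t : ∀ y, V.fib y) (y₀ : Y), V.HolAt t y₀ → (∀ᶠ y in 𝓝 y₀, p.app y (t y) = 0) →
      ∃ v : ∀ y, U.fib y, U.HolAt v y₀ ∧ ∀ᶠ y in 𝓝 y₀, i.app y (v y) = t y)
    (T : HolSheaf I Y) (k : ℕ) {C : PCover Y} (σ : (W.hom V).Cochain C 0)
    (θ : (W.hom U).Cocycle C 1)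
    (hσ : ∀ (x : Fin 1 → Y) (y : C.inter x), p.app y ∘ₗ (σ x).1 y = LinearMap.id)
    (hθ : (i.postcomp W).cochain C 1 θ.1 = (W.hom V).δ C 0 σ)
    (c : (T.hom (filt i k 1)).Cocycle C 1) :
    (compWedge T U W k).cup ((W.hom U).cls θ)
      (((filtGr i p hi (fun y => (hex y).linearMap_comp_eq_zero) k).postcomp T).coh 1
        ((T.hom (filt i k 1)).cls c)) = 0 := by
  have hpi := fun y => (hex y).linearMap_comp_eq_zero
  obtain ⟨r, hri, hrhol, hrθ⟩ := exists_local_retractions i p hi hex hgerm σ θ.1 hσ hθ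
  -- The bounding cochain is `e_{xx'} = ∧ᵏ⁺¹(r_x) ∘ c_{xx'}`, with the retraction taken at the first
  -- index. If the `r_x` agreed on overlaps, this would be a cocycle with values in `ℋom(T, ∧ᵏ⁺¹U)`;
  -- its coboundary measures their disagreement.
  obtain ⟨e, he⟩ := (T.hom (U.extPow (k + 1))).exists_cochain (C := C) (n := 1)
    (fun x y => extPowMap (r (x 0) y) (k + 1) ∘ₗ
      (LinearMap.range (wedgeMul (i.app y) k 1)).subtype ∘ₗ evHom T (filt i k 1) c.1 x y)
    (fun x y hy t ht => by
      have hy' : y ∈ C.set (x 0) := PCover.mem_inter.1 hy 0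
      exact holAt_extPowMap i k (hrhol _ y hy')
        (Filter.eventually_of_mem ((C.set (x 0)).isOpen.mem_nhds hy') fun z hz => hri _ z hz)
        (holAt_ev _ c.1 x hy t ht))
  -- The coboundary of `e` is minus the cup cochain, so the negated class is the one shown to be
  -- zero.
  rw [Hom.coh_cls, Pairing.cup_cls, ← neg_eq_zero]
  refine (map_neg (T.hom (U.extPow (k + 1))).cls _).symm.trans (cls_eq_zero _ _ e ?_)
  refine cochain_ext _ fun x y hy => ?_
  have hk : ∀ m, y ∈ C.set (x m) := PCover.mem_inter.1 hy
  rw [ev_δ₁ _ _ _ hy, he _ _ (mem_inter₂ (hk 1) (hk 2)), he _ _ (mem_inter₂ (hk 0) (hk 2)),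
    he _ _ (mem_inter₂ (hk 0) (hk 1))]
  have hneg : (T.hom (U.extPow (k + 1))).ev (-((compWedge T U W k).cupCochain θ.1
      (((filtGr i p hi hpi k).postcomp T).cocycle C 1 c).1)) x y =
      -(T.hom (U.extPow (k + 1))).ev ((compWedge T U W k).cupCochain θ.1
      (((filtGr i p hi hpi k).postcomp T).cocycle C 1 c).1) x y := by
    rw [ev_mem _ _ _ hy, ev_mem _ _ _ hy]; rfl
  refine hneg.trans ?_
  have hgr : (T.hom ((U.extPow k).tensor W)).ev
      (((filtGr i p hi hpi k).postcomp T).cocycle C 1 c).1 ![x 1, x 2] y = _ :=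
    ev_cochain ((filtGr i p hi hpi k).postcomp T) c.1 _ (mem_inter₂ (hk 1) (hk 2))
  -- Substituting `c₀₂ = c₀₁ + c₁₂` into `(δe)₀₁₂ = ∧r₁ c₁₂ - ∧r₀ c₀₂ + ∧r₀ c₀₁` cancels the `c₀₁`
  -- terms and leaves `(∧r₁ - ∧r₀) c₁₂`.
  have hc : evHom T (filt i k 1) c.1 ![x 0, x 2] y =
      evHom T (filt i k 1) c.1 ![x 0, x 1] y + evHom T (filt i k 1) c.1 ![x 1, x 2] y :=
    cocycle₁ _ c (hk 0) (hk 1) (hk 2)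
  rw [Pairing.ev_cupCochain _ _ _ _ hy, hgr, hc]
  refine LinearMap.ext fun t => ?_
  -- With `r = r₁`, `r' = r₀` and `r₀ - r₁ = θ₀₁ ∘ p`, the difference `(∧r₀ - ∧r₁) c₁₂` is the
  -- product of `θ₀₁` with `gr c₁₂`. The indices match those of the cup product `(a ∪ b)₀₁₂ = a₀₁ ·
  -- b₁₂`.
  have key := extPowMap_sub_extPowMap (hi y) (hpi y) (hri _ y (hk 1)) (hri _ y (hk 0))
    (hrθ _ _ y (hk 0) (hk 1)) k (evHom T (filt i k 1) c.1 ![x 1, x 2] y t)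
  refine (congrArg Neg.neg key.symm).trans ?_
  -- From here `a` is `c₁₂` and `a'` is `c₀₁`; only additivity of `∧ᵏ⁺¹r₀` is left to use.
  generalize evHom T (filt i k 1) c.1 ![x 1, x 2] y = a
  generalize evHom T (filt i k 1) c.1 ![x 0, x 1] y = a'
  change -(extPowMap (r (x 0) y) (k + 1) (a t).1 - extPowMap (r (x 1) y) (k + 1) (a t).1) =
    extPowMap (r (x 1) y) (k + 1) (a t).1 -
      extPowMap (r (x 0) y) (k + 1) ((a' t).1 + (a t).1) +
      extPowMap (r (x 0) y) (k + 1) (a' t).1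
  rw [map_add]
  abel

end HolSheaf

/-! ### The model class map on classes that lift to `F_b`. -/

namespace GTModel

open HolSheaf

variable {EX : Type u} [NormedAddCommGroup EX] [NormedSpace ℂ EX]
  {HX : Type u} [TopologicalSpace HX] {IX : ModelWithCorners ℂ EX HX}
  {X : Type u} [TopologicalSpace X] [ChartedSpace HX X]
  {EB : Type u} [NormedAddCommGroup EB] [NormedSpace ℂ EB]
  {HB : Type u} [TopologicalSpace HB] {IB : ModelWithCorners ℂ EB HB}
  {B : Type u} [TopologicalSpace B] [ChartedSpace HB B]
  {TX : HolSheaf IX X} {TB : HolSheaf IB B} {TY : HolSheaf (IX.prod IB) (X × B)}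
  [IsManifold (IX.prod IB) ω (X × B)]

/-- The model class map vanishes on classes which lift to `H¹(Y, ℋom(T^*_{Y,(±)^{b+1}}, F_b))`. -/
theorem modelClassMap_grMapCoh (S : GTModel TX TB TY)
    {Θ : ((TX.pullback (IX.prod IB) Prod.fst).hom
      (TB.pullback (IX.prod IB) Prod.snd)).Coh 1} (hΘ : S.IsModelClass Θ) (b : ℕ)
    (w : ((TY.tpm (b + 1)).hom (filt S.incl b 1)).Coh 1) :
    S.modelClassMap Θ b (S.grMapCoh b w) = 0 := by
  obtain ⟨C, σ, θ, hσ, hθ, rfl⟩ := hΘ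
  obtain ⟨C', c, rfl⟩ := exists_cls _ w
  -- The splittings defining `Θ` and the cocycle representing `w` live on unrelated covers `C` and
  -- `C'`. Both classes are represented on the common refinement, where the cochain computation
  -- applies.
  rw [← cls_refine _ (C.le_inf_left C') θ (refineCocycle _ (C.le_inf_left C') 1 θ) rfl,
    ← cls_refine _ (C.le_inf_right C') c (refineCocycle _ (C.le_inf_right C') 1 c) rfl]
  refine cup_filtGr_cls_eq_zero S.incl S.proj S.incl_injective S.exact S.exact_germ
    (TY.tpm (b + 1)) b (refineCochain _ (C.le_inf_left C') 0 σ) _ (fun x y => ?_) ?_ _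
  -- Refinement only restricts sections, so a refined splitting is still a splitting; it also
  -- commutes with `δ`, which keeps the relation between `σ` and `θ`.
  · exact hσ x ⟨y, PCover.inter_mono (C.le_inf_left C') x y.2⟩
  · rw [← refineCochain_δ, ← hθ]
    rfl

end GTModel

/-! ### The theorem, with `j' = b + 1`. -/

theorem mainTheorem12
    {EX : Type u} [NormedAddCommGroup EX] [NormedSpace ℂ EX] [FiniteDimensional ℂ EX]
    {X : Type u} [TopologicalSpace X] [T2Space X] [ParacompactSpace X]
    [ChartedSpace EX X] [IsManifold 𝓘(ℂ, EX) ω X]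
    {EB : Type u} [NormedAddCommGroup EB] [NormedSpace ℂ EB] [FiniteDimensional ℂ EB]
    {B : Type u} [TopologicalSpace B] [T2Space B] [ParacompactSpace B]
    [ChartedSpace EB B] [IsManifold 𝓘(ℂ, EB) ω B]
    (FX : Type u) [NormedAddCommGroup FX] [NormedSpace ℂ FX] [FiniteDimensional ℂ FX]
    (TX : X → Type u) [TopologicalSpace (Bundle.TotalSpace FX TX)] [∀ x, AddCommGroup (TX x)]
    [∀ x, Module ℂ (TX x)] [∀ x, TopologicalSpace (TX x)] [FiberBundle FX TX]
    [VectorBundle ℂ FX TX] [ContMDiffVectorBundle ω FX TX 𝓘(ℂ, EX)]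
    (FB : Type u) [NormedAddCommGroup FB] [NormedSpace ℂ FB] [FiniteDimensional ℂ FB]
    (TB : B → Type u) [TopologicalSpace (Bundle.TotalSpace FB TB)] [∀ b, AddCommGroup (TB b)]
    [∀ b, Module ℂ (TB b)] [∀ b, TopologicalSpace (TB b)] [FiberBundle FB TB]
    [VectorBundle ℂ FB TB] [ContMDiffVectorBundle ω FB TB 𝓘(ℂ, EB)]
    (FY : Type u) [NormedAddCommGroup FY] [NormedSpace ℂ FY] [FiniteDimensional ℂ FY]
    (TY : X × B → Type u) [TopologicalSpace (Bundle.TotalSpace FY TY)]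
    [∀ y, AddCommGroup (TY y)] [∀ y, Module ℂ (TY y)] [∀ y, TopologicalSpace (TY y)]
    [FiberBundle FY TY] [VectorBundle ℂ FY TY]
    [ContMDiffVectorBundle ω FY TY (𝓘(ℂ, EX).prod 𝓘(ℂ, EB))]
    (S : GTModel (HolSheaf.ofBundle 𝓘(ℂ, EX) FX TX) (HolSheaf.ofBundle 𝓘(ℂ, EB) FB TB)
      (HolSheaf.ofBundle (𝓘(ℂ, EX).prod 𝓘(ℂ, EB)) FY TY))
    (Θ : (((HolSheaf.ofBundle 𝓘(ℂ, EX) FX TX).pullback (𝓘(ℂ, EX).prod 𝓘(ℂ, EB)) Prod.fst).hom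
      ((HolSheaf.ofBundle 𝓘(ℂ, EB) FB TB).pullback (𝓘(ℂ, EX).prod 𝓘(ℂ, EB)) Prod.snd)).Coh 1)
    (hΘ : S.IsModelClass Θ) (hΘ_ne : Θ ≠ 0)
    (b : ℕ) (hb : 1 ≤ b) (ν : S.H1 b 1) (hν : S.modelClassMap Θ b ν ≠ 0) :
    ∃ ν' : S.H1 b 1, ν' ≠ 0 ∧ ∀ 𝓕 : S.GtmFamily (b + 1), ¬ 𝓕.IsSecondaryObstruction ν' := by
  refine ⟨ν, fun h => hν (by rw [h, map_zero]), ?_⟩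
  -- A secondary obstruction is the image of some `w` under `grMapCoh`. Such images are killed by
  -- the model class map, contrary to the choice of `ν`.
  rintro 𝓕 ⟨o, -, -, w, -, rfl⟩
  exact hν (S.modelClassMap_grMapCoh hΘ b w)
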